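/- Let $\mathcal M=\mathcal M(\Sigma,I)$ be the trace monoid over a finite alphabet $\Sigma$ with irreflexive symmetric independence relation $I$, i.e. the quotient of the free monoid $\Sigma^*$ by the congruence generated by $ab=ba$ for $(a,b)\in I$, ordered by left divisibility ($x\le y$ iff $y=xz$ for some $z$). A clique is a finite set $c$ of pairwise independent letters, identified with the product $c\in\mathcal M$ of its letters; $\mathscr C$ is the set of cliques, $\mathfrak C=\mathscr C\setminus\{1\}$ the set of non-empty ones, and for $\gamma,\gamma'\in\mathfrak C$ one writes $\gamma\to\gamma'$ if for every $b\in\gamma'$ there is $a\in\gamma$ with $(a,b)\notin I$. Let $\overline{\mathcal M}$ be the partial order of generalised traces (the completion of $(\mathcal M,\le)$ by least upper bounds of non-decreasing sequences) and $\partial\mathcal M=\overline{\mathcal M}\setminus\mathcal M$ the boundary, with the Borel $\sigma$-algebra of the Lawson topology; for $x\in\mathcal M$ let $\uparrow x=\{\xi\in\partial\mathcal M: x\le\xi\}$. Let $\mathcal M$ act on the right on a finite set $X$, $(\alpha,x)\mapsto\alpha\cdot x$. A fibred valuation is a family $F=(f_\alpha)_{\alpha\in X}$ of functions $f_\alpha:\mathcal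 M\to\mathbb R$ with $f_\alpha(1)=1$ and $f_\alpha(xy)=f_\alpha(x)f_{\alpha\cdot x}(y)$ for all $\alpha\in X$ and $x,y\in\mathcal M$. Put $h_\alpha(c)=\sum_{c'\in\mathscr C,\,c'\ge c}(-1)^{|c'|-|c|}f_\alpha(c')$ for $c\in\mathscr C$; $F$ is Möbius if $h_\alpha(1)=0$ and $h_\alpha(\gamma)\ge 0$ for all $\alpha\in X$ and $\gamma\in\mathfrak C$. A Markov measure is a family $\mathbb P=(\mathbb P_\alpha)_{\alpha\in X}$ of probability measures on $\partial\mathcal M$ with $\mathbb P_\alpha(\uparrow(xy))=\mathbb P_\alpha(\uparrow x)\,\mathbb P_{\alpha\cdot x}(\uparrow y)$ for all $\alpha\in X$ and $x,y\in\mathcal M$. For $\alpha\in X$ and $\gamma\in\mathfrak C$ let $g_{\alpha}(\gamma)=\sum_{\gamma'\in\mathfrak C,\,\gamma\to\gamma'}h_{\alpha}(\gamma')$, and let $P$ be the matrix on $X\times\mathfrak C$ given by $$P_{(\alpha,\gamma),(\alpha',\gamma')}=\mathbf 1_{\{\alpha'=\alpha\cdot\gamma\}}\mathbf 1_{\{\gamma\to\gamma'\}}\frac{h_{\alpha'}(\gamma')}{g_{\alpha'}(\gamma)},$$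 to be read as $0$ if $g_{\alpha'}(\gamma)=0$. Theorem. Let $F=(f_\alpha)_{\alpha\in X}$ be a Möbius fibred valuation. Then there is a unique Markov measure $\mathbb P=(\mathbb P_\alpha)_{\alpha\in X}$ such that $f_\alpha(x)=\mathbb P_\alpha(\uparrow x)$ for all $\alpha\in X$ and $x\in\mathcal M$. Moreover, for every $\alpha\in X$, there is a unique probability measure $\mathbb Q_\alpha$ on the canonical space $(X\times\mathfrak C)^{\mathbb N}$ under which the coordinate process $(X_{i-1},C_i)_{i\ge1}$ is a Markov chain with initial measure $\delta_{\{\alpha\}}\otimes(h_\alpha|_{\mathfrak C})$ and transition matrix $P$, that is, $$\mathbb Q_\alpha\bigl((X_0,C_1)=z_0,\dots,(X_n,C_{n+1})=z_n\bigr)=\bigl(\delta_{\{\alpha\}}\otimes h_\alpha|_{\mathfrak C}\bigr)(z_0)\prod_{i=0}^{n-1}P_{z_i,z_{i+1}}$$ for all $n\ge 0$ and $z_0,\dots,z_n\in X\times\mathfrak C$; and whenever $(X_{i-1},C_i)_{i\ge1}$ is such a chain on some probability space, the $\partial\mathcal M$-valued map $$\xi=\bigvee_{n\ge1}(C_1\cdot\ldots\cdot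 C_n)$$ is measurable and its law is $\mathbb P_\alpha$. -/

import Mathlib

open MeasureTheory

noncomputable section

/-! ## Trace monoids

The alphabet is a type `A`; an independence relation on `A` (irreflexive and symmetric) is a
`SimpleGraph A`, whose adjacency `I.Adj a b` means `(a, b) ∈ I`. -/

/-- The trace monoid `M(A, I)`: the quotient of the free monoid on `A` by the smallest congruence
containing the pairs `(ab, ba)` for `(a, b) ∈ I`. -/
def TraceMonoid {A : Type*} (I : SimpleGraph A) : Type _ :=
  PresentedMonoid (fun u v : FreeMonoid A =>
    ∃ a b : A, I.Adj a b ∧ u = FreeMonoid.of a * FreeMonoid.of b ∧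
      v = FreeMonoid.of b * FreeMonoid.of a)

namespace TraceMonoid

variable {A : Type*} {I : SimpleGraph A}

instance : Monoid (TraceMonoid I) := inferInstanceAs (Monoid (PresentedMonoid _))

/-- The trace of length one given by a letter. -/
def of (I : SimpleGraph A) (a : A) : TraceMonoid I := PresentedMonoid.of _ a

theorem of_commute {a b : A} (h : I.Adj a b) : Commute (of I a) (of I b) :=
  PresentedMonoid.mk_eq_mk_of_rel ⟨a, b, h, rfl, rfl⟩

/-- The length of traces, as a monoid homomorphism to `(ℕ, +)`. -/
def lengthHom (I : SimpleGraph A) : TraceMonoid I →* Multiplicative ℕ :=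
  PresentedMonoid.lift (fun _ => Multiplicative.ofAdd 1) (by
    rintro _ _ ⟨a, b, -, rfl, rfl⟩
    simp)

/-- The length of a trace. -/
def length (x : TraceMonoid I) : ℕ := Multiplicative.toAdd (lengthHom I x)

theorem length_one : length (1 : TraceMonoid I) = 0 := by simp [length]

theorem length_mul (x y : TraceMonoid I) : length (x * y) = length x + length y := by
  simp [length]

theorem length_of (a : A) : length (of I a) = 1 := rfl

theorem eq_one_of_length_eq_zero (x : TraceMonoid I) (h : length x = 0) : x = 1 := by
  obtain ⟨w, rfl⟩ := PresentedMonoid.surjective_mk x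
  induction w using FreeMonoid.casesOn with
  | one => rfl
  | of_mul a w =>
    have key : ∀ y : TraceMonoid I, length (of I a * y) ≠ 0 := fun y => by
      rw [length_mul, length_of]
      omega
    exact absurd h (key (PresentedMonoid.mk _ w))

/-- Traces are ordered by left divisibility: `x ≤ y` iff `y = x * z` for some `z`. -/
instance : PartialOrder (TraceMonoid I) where
  le x y := ∃ z, y = x * z
  le_refl x := ⟨1, (mul_one x).symm⟩
  le_trans := by
    rintro x _ _ ⟨u, rfl⟩ ⟨v, rfl⟩
    exact ⟨u * v, mul_assoc _ _ _⟩
  le_antisymm := by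
    rintro x y ⟨u, hu⟩ ⟨v, hv⟩
    have h1 := congrArg length hu
    have h2 := congrArg length hv
    rw [length_mul] at h1 h2
    have : u = 1 := eq_one_of_length_eq_zero u (by omega)
    rw [hu, this, mul_one]

theorem length_mono {x y : TraceMonoid I} (h : x ≤ y) : length x ≤ length y := by
  obtain ⟨z, rfl⟩ := h
  rw [length_mul]
  omega

end TraceMonoid

/-! ## Cliques -/

/-- Cliques, seen as sets of pairwise independent letters. They are ordered by inclusion, which is
the restriction of the divisibility order to cliques. -/
abbrev Clique {A : Type*} (I : SimpleGraph A) : Type _ := {s : Finset A // I.IsClique (s : Set A)}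

namespace Clique

variable {A : Type*} {I : SimpleGraph A}

/-- The empty clique. -/
def empty (I : SimpleGraph A) : Clique I := ⟨∅, by simp⟩

theorem pairwise_commute (c : Clique I) :
    (c.1 : Set A).Pairwise (Function.onFun Commute (TraceMonoid.of I)) :=
  fun _ ha _ hb hab => TraceMonoid.of_commute (c.2 ha hb hab)

/-- The trace `a₁ ⋯ aₖ` of the clique `{a₁, …, aₖ}`. -/
def toTrace (c : Clique I) : TraceMonoid I :=
  c.1.noncommProd (TraceMonoid.of I) c.pairwise_commute

theorem length_toTrace (c : Clique I) : c.toTrace.length = c.1.card := by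
  rw [toTrace, TraceMonoid.length, Finset.map_noncommProd, Finset.noncommProd_eq_prod]
  have : ∀ a, TraceMonoid.lengthHom I (TraceMonoid.of I a) = Multiplicative.ofAdd 1 :=
    fun _ => rfl
  simp [this]

instance [Finite A] : Fintype (Clique I) := Fintype.ofFinite _

end Clique

/-- Non empty cliques. -/
def NonemptyClique {A : Type*} (I : SimpleGraph A) : Type _ := {c : Clique I // c.1.Nonempty}

namespace NonemptyClique

variable {A : Type*} {I : SimpleGraph A}

/-- The trace of a non empty clique. -/
def toTrace (c : NonemptyClique I) : TraceMonoid I := c.1.toTrace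

/-- The Cartier-Foata relation `c → c'`: every letter of `c'` is blocked by some letter of `c`. -/
def CartierFoata (c c' : NonemptyClique I) : Prop :=
  ∀ b ∈ c'.1.1, ∃ a ∈ c.1.1, ¬ I.Adj a b

instance [Finite A] : Fintype (NonemptyClique I) :=
  @Fintype.ofFinite _ (inferInstanceAs (Finite {c : Clique I // c.1.Nonempty}))

/-- The discrete `σ`-algebra on the finite set of non empty cliques. -/
instance : MeasurableSpace (NonemptyClique I) := ⊤

end NonemptyClique

/-! ## Generalised traces and the boundary -/

/-- Generalised traces: the completion of the trace monoid by suprema of non decreasing sequences,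
realised as the ideal completion of `(TraceMonoid I, ≤)`, ordered by inclusion (the monoid being
countable when the alphabet is finite, ideals are the same thing as non decreasing sequences of
traces up to mutual domination). -/
def GenTrace {A : Type*} (I : SimpleGraph A) : Type _ := Order.Ideal (TraceMonoid I)

namespace GenTrace

variable {A : Type*} {I : SimpleGraph A}

instance : PartialOrder (GenTrace I) :=
  inferInstanceAs (PartialOrder (Order.Ideal (TraceMonoid I)))

/-- The canonical embedding of traces into generalised traces. -/
def ofTrace (x : TraceMonoid I) : GenTrace I := Order.Ideal.principal x

/-- The Lawson topology: it is generated by the full elementary cylinders `{ζ | x ≤ ζ}` with `x` a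
trace, and by the complements of the sets `{ζ | ξ ≤ ζ}` with `ξ` a generalised trace. -/
instance : TopologicalSpace (GenTrace I) :=
  TopologicalSpace.generateFrom
    (Set.range (fun x : TraceMonoid I => Set.Ici (ofTrace x)) ∪
      Set.range (fun ξ : GenTrace I => (Set.Ici ξ)ᶜ))

end GenTrace

/-- The boundary at infinity: the generalised traces that are not traces. -/
def Boundary {A : Type*} (I : SimpleGraph A) : Type _ :=
  {ξ : GenTrace I // ξ ∉ Set.range (GenTrace.ofTrace (I := I))}

namespace Boundary

variable {A : Type*} {I : SimpleGraph A}

instance : TopologicalSpace (Boundary I) :=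
  inferInstanceAs (TopologicalSpace
    {ξ : GenTrace I // ξ ∉ Set.range (GenTrace.ofTrace (I := I))})

/-- The Borel `σ`-algebra of the boundary. -/
instance : MeasurableSpace (Boundary I) := borel _

instance : BorelSpace (Boundary I) := ⟨rfl⟩

/-- The elementary cylinder `↑x = {ξ ∈ ∂M | x ≤ ξ}`. -/
def cylinder (x : TraceMonoid I) : Set (Boundary I) := {ξ | GenTrace.ofTrace x ≤ ξ.1}

end Boundary

/-! ## The infinite trace generated by a sequence of non empty cliques -/

section Sup

variable {A : Type*} {I : SimpleGraph A}

/-- The product `c₀ ⋯ cₙ₋₁` of the first `n` cliques of a sequence. -/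
def partialProd (c : ℕ → NonemptyClique I) : ℕ → TraceMonoid I
  | 0 => 1
  | n + 1 => partialProd c n * (c n).toTrace

theorem partialProd_mono (c : ℕ → NonemptyClique I) : Monotone (partialProd c) :=
  monotone_nat_of_le_succ fun n => ⟨(c n).toTrace, rfl⟩

theorem le_length_partialProd (c : ℕ → NonemptyClique I) (n : ℕ) :
    n ≤ (partialProd c n).length := by
  induction n with
  | zero => exact Nat.zero_le _
  | succ n ih =>
    have h : 0 < (c n).toTrace.length := by
      rw [NonemptyClique.toTrace, Clique.length_toTrace]
      exact Finset.card_pos.2 (c n).2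
    rw [partialProd, TraceMonoid.length_mul]
    omega

/-- The infinite trace `⋁ₙ c₀ ⋯ cₙ₋₁`: the ideal of the traces that divide some partial product.
It is the least upper bound of the partial products by `isLUB_infiniteTrace`. -/
def infiniteTrace (c : ℕ → NonemptyClique I) : Boundary I :=
  ⟨{ carrier := {x | ∃ n, x ≤ partialProd c n}
     lower' := fun _ _ hyx ⟨n, hn⟩ => ⟨n, le_trans hyx hn⟩
     nonempty' := ⟨1, 0, le_refl _⟩
     directed' := by
      rintro x ⟨n, hn⟩ y ⟨m, hm⟩
      exact ⟨partialProd c (max n m), ⟨_, le_refl _⟩,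
        hn.trans (partialProd_mono c (le_max_left _ _)),
        hm.trans (partialProd_mono c (le_max_right _ _))⟩ }, by
    rintro ⟨x, hx⟩
    have h : partialProd c (x.length + 1) ∈ Order.Ideal.principal x := by
      change Order.Ideal.principal x = _ at hx
      rw [hx]
      exact ⟨_, le_refl _⟩
    have h' := TraceMonoid.length_mono (Order.Ideal.mem_principal.1 h)
    have := le_length_partialProd c (x.length + 1)
    omega⟩

theorem isLUB_infiniteTrace (c : ℕ → NonemptyClique I) :
    IsLUB {ξ : GenTrace I | ∃ n : ℕ, 1 ≤ n ∧ ξ = GenTrace.ofTrace (partialProd c n)}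
      (infiniteTrace c).1 := by
  constructor
  · rintro _ ⟨n, -, rfl⟩ x hx
    exact ⟨n, Order.Ideal.mem_principal.1 hx⟩
  · rintro ξ hξ x ⟨n, hn⟩
    exact hξ ⟨n + 1, by omega, rfl⟩
      (Order.Ideal.mem_principal.2 (hn.trans (partialProd_mono c (Nat.le_succ n))))

end Sup

/-! ## Fibred valuations and Markov measures

A total (right) action of the trace monoid on `X` is a `MulAction` of the opposite monoid. -/

section Action

variable {A : Type*} {I : SimpleGraph A} {X : Type*}

/-- The state `α · x` reached from `α` by the action of the trace `x`. -/
def actBy [MulAction (TraceMonoid I)ᵐᵒᵖ X] (α : X) (x : TraceMonoid I) : X :=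
  MulOpposite.op x • α

/-- Fibred valuations: `f_α(1) = 1` and `f_α(x y) = f_α(x) f_{α·x}(y)`. -/
structure IsFibredValuation [MulAction (TraceMonoid I)ᵐᵒᵖ X]
    (f : X → TraceMonoid I → ℝ) : Prop where
  map_one : ∀ α, f α 1 = 1
  map_mul : ∀ α x y, f α (x * y) = f α x * f (actBy α x) y

/-- Markov measures: families of probability measures on the boundary satisfying the chain rule
`P_α(↑(x y)) = P_α(↑x) P_{α·x}(↑y)`. -/
structure IsMarkovMeasure [MulAction (TraceMonoid I)ᵐᵒᵖ X]
    (P : X → Measure (Boundary I)) : Prop where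
  isProbabilityMeasure : ∀ α, IsProbabilityMeasure (P α)
  chain_rule : ∀ α x y, (P α).real (Boundary.cylinder (x * y)) =
    (P α).real (Boundary.cylinder x) * (P (actBy α x)).real (Boundary.cylinder y)

open Classical in
/-- The Möbius transform `h(c) = ∑_{c' ≥ c} (-1)^(|c'| - |c|) f(c')`, over cliques `c'`. -/
def moebiusTransform [Finite A] (f : TraceMonoid I → ℝ) (c : Clique I) : ℝ :=
  ∑ c' : Clique I with c ≤ c', (-1 : ℝ) ^ (c'.1.card - c.1.card) * f c'.toTrace

/-- A family `f` is Möbius if the Möbius transform of each `f_α` vanishes at the empty clique and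
is non negative at the non empty ones. -/
structure IsMoebius [Finite A] (f : X → TraceMonoid I → ℝ) : Prop where
  empty : ∀ α, moebiusTransform (f α) (Clique.empty I) = 0
  nonneg : ∀ α, ∀ c : NonemptyClique I, 0 ≤ moebiusTransform (f α) c.1

open Classical in
/-- The normalisation `g_α(γ) = ∑_{γ → γ'} h_α(γ')`, over non empty cliques `γ'`. -/
def normalisation [Finite A] (f : X → TraceMonoid I → ℝ) (α : X) (γ : NonemptyClique I) : ℝ :=
  ∑ γ' : NonemptyClique I with γ.CartierFoata γ', moebiusTransform (f α) γ'.1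

open Classical in
/-- The transition matrix of the chain of states-and-cliques: from `(α, γ)` to `(α', γ')` it is
`h_{α'}(γ') / g_{α'}(γ)` if `α' = α · γ` and `γ → γ'` and `g_{α'}(γ) ≠ 0`, and `0` otherwise. -/
def transitionMatrix [Finite A] [MulAction (TraceMonoid I)ᵐᵒᵖ X] (f : X → TraceMonoid I → ℝ)
    (s t : X × NonemptyClique I) : ℝ :=
  if t.1 = actBy s.1 s.2.toTrace ∧ s.2.CartierFoata t.2 ∧ normalisation f t.1 s.2 ≠ 0 then
    moebiusTransform (f t.1) t.2.1 / normalisation f t.1 s.2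
  else 0

open Classical in
/-- The initial weights `δ_α ⊗ h_α` of the chain of states-and-cliques. -/
def initialWeight [Finite A] (f : X → TraceMonoid I → ℝ) (α : X)
    (s : X × NonemptyClique I) : ℝ :=
  if s.1 = α then moebiusTransform (f α) s.2.1 else 0

end Action

/-- The sequence of random variables `Z` is, under the probability measure `Q`, a homogeneous
Markov chain on the countable (discrete) set `E` with initial distribution `ν` and transition
matrix `P`:
`Q(Z₀ = z₀, …, Zₙ = zₙ) = ν(z₀) P(z₀, z₁) ⋯ P(zₙ₋₁, zₙ)` for all `n` and `z₀, …, zₙ`. -/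
structure IsMarkovChain {E Ω : Type*} [MeasurableSpace E] [MeasurableSpace Ω] (ν : E → ℝ)
    (P : E → E → ℝ) (Q : Measure Ω) (Z : ℕ → Ω → E) : Prop where
  isProbabilityMeasure : IsProbabilityMeasure Q
  measurable : ∀ i, Measurable (Z i)
  law : ∀ (n : ℕ) (z : ℕ → E), Q.real {ω | ∀ i ≤ n, Z i ω = z i} =
    ν (z 0) * ∏ i ∈ Finset.range n, P (z i) (z (i + 1))

end

/-! Let `D n` be the set of products of `n` cliques: it is finite, closed under divisors, and
contains every trace of length at most `n`. Everything rests on the law of `Y = C₁ ⋯ Cₙ₊₁`: for `y`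
in `D (n+1)`, `Q(Y = y) = ∑ (-1)^|d| f_α(y d)` over the cliques `d` with `y d` in `D (n+1)`
(`measureReal_partialProd_eq`).

If `y` is not in `D n`, it has a unique Cartier-Foata form `c₀ → ⋯ → cₙ`. The identity `h_α(γ) =
f_α(γ) g_{α·γ}(γ)` makes the weight of that path telescope to `f_α(c₀ ⋯ cₙ₋₁) h(cₙ)`, with `h` taken
at the state reached, and a clique `d` can be appended inside `D (n+1)` exactly when it is parallel
to `cₙ`. If `y` is in `D n`, every clique can be appended and the sum is `f_α(y) h_{α·y}(1) = 0`,
while almost surely `Y` has a normal form of `n+1` non-empty cliques, so is not in `D n`.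

Möbius inversion in `D (n+1)` (`sum_graded_moebius`) then gives `Q(x ≤ Y) = f_α(x)` for `x` in `D
(n+1)`. These events increase with `n` to `{ξ ∈ ↑x}`, so the law of `ξ` gives `↑x` the mass
`f_α(x)`. The cylinders form a π-system generating the Borel σ-algebra, hence uniqueness; the chain
rule is the multiplicativity of `f`. -/

noncomputable section

open scoped Pointwise Topology
open TraceMonoid

/-! ### Divisibility in the trace monoid: Levi's lemma, cancellation, suprema -/

namespace TraceMonoid

variable {A : Type*} {I : SimpleGraph A}

theorem induction_on {p : TraceMonoid I → Prop} (x : TraceMonoid I) (one : p 1)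
    (of_mul : ∀ a x, p x → p (of I a * x)) : p x := by
  obtain ⟨w, rfl⟩ := PresentedMonoid.surjective_mk x
  induction w using FreeMonoid.inductionOn' with
  | one => exact one
  | of_mul a w ih => exact of_mul a _ ih

open Classical in
/-- One step of the removal of the letter `a`: the state is a trace, together with what remains of
it once a leading `a` is removed, if there is one. -/
def removeStep (I : SimpleGraph A) (a b : A) :
    Function.End (TraceMonoid I × Option (TraceMonoid I)) :=
  fun s => (of I b * s.1,
    if b = a then some s.1 else if I.Adj a b then s.2.map (of I b * ·) else none)

/-- The compatibility with `bc = cb` that lets removal descend to the quotient. Levi's lemma and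
left cancellation are then read off from `remove`. -/
theorem removeStep_commute (a : A) {b c : A} (h : I.Adj b c) :
    removeStep I a b * removeStep I a c = removeStep I a c * removeStep I a b := by
  have hc := of_commute h
  funext ⟨x, r⟩
  have h1 : of I b * (of I c * x) = of I c * (of I b * x) := by
    rw [← mul_assoc, hc.eq, mul_assoc]
  have h2 : ∀ y, of I b * (of I c * y) = of I c * (of I b * y) := fun y => by
    rw [← mul_assoc, hc.eq, mul_assoc]
  change removeStep I a b (removeStep I a c (x, r)) = removeStep I a c (removeStep I a b (x, r))
  have hne := h.ne
  simp only [removeStep, h1, Prod.mk.injEq, true_and]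
  by_cases hb : b = a
  · subst hb
    simp [h, hne.symm]
  · by_cases hc' : c = a
    · subst hc'
      simp [h.symm, hb]
    · by_cases h3 : I.Adj a b <;> by_cases h4 : I.Adj a c <;>
        simp [hb, hc', h3, h4, Function.comp_def, h2]

/-- The removal of a leading letter `a`, as a monoid homomorphism. -/
def removeHom (I : SimpleGraph A) (a : A) :
    TraceMonoid I →* Function.End (TraceMonoid I × Option (TraceMonoid I)) :=
  PresentedMonoid.lift (removeStep I a) (by
    rintro _ _ ⟨b, c, h, rfl, rfl⟩
    simpa using removeStep_commute a h)

theorem removeHom_of (a b : A) : removeHom I a (of I b) = removeStep I a b :=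
  PresentedMonoid.lift_of _ _

theorem removeHom_of_mul (a b : A) (x : TraceMonoid I) (s) :
    removeHom I a (of I b * x) s = removeStep I a b (removeHom I a x s) := by
  rw [map_mul, removeHom_of]; rfl

theorem removeHom_fst (a : A) (x : TraceMonoid I) : (removeHom I a x (1, none)).1 = x := by
  induction x using induction_on with
  | one => rw [map_one]; rfl
  | of_mul b x ih => rw [removeHom_of_mul]; simp [removeStep, ih]

/-- The trace `y` such that `x = a y`, if there is one. -/
def remove (a : A) (x : TraceMonoid I) : Option (TraceMonoid I) := (removeHom I a x (1, none)).2

open Classical in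
theorem remove_of_mul (a b : A) (x : TraceMonoid I) : remove a (of I b * x) =
    if b = a then some x else if I.Adj a b then (remove a x).map (of I b * ·) else none := by
  rw [remove, removeHom_of_mul, removeStep, removeHom_fst]; rfl

theorem remove_one (a : A) : remove a (1 : TraceMonoid I) = none := by
  rw [remove, map_one]; rfl

theorem eq_of_remove {a : A} {x y : TraceMonoid I} (h : remove a x = some y) :
    x = of I a * y := by
  induction x using induction_on generalizing y with
  | one => rw [remove_one] at h; cases h
  | of_mul b x ih =>
    rw [remove_of_mul] at h
    split_ifs at h with h1 h2
    · rw [h1, Option.some_injective _ h]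
    · obtain ⟨z, hz, rfl⟩ := Option.map_eq_some_iff.1 h
      rw [ih hz, ← mul_assoc, ← mul_assoc, (of_commute h2).eq]

theorem of_mul_cancel {a : A} {x y : TraceMonoid I} (h : of I a * x = of I a * y) : x = y := by
  have := congrArg (remove a) h
  simpa [remove_of_mul] using this

/-- Levi's lemma for two distinct leading letters. -/
theorem levi {a b : A} (hab : a ≠ b) {x y : TraceMonoid I} (h : of I a * x = of I b * y) :
    I.Adj a b ∧ ∃ z, x = of I b * z ∧ y = of I a * z := by
  have := congrArg (remove a) h
  rw [remove_of_mul, remove_of_mul, if_pos rfl, if_neg hab.symm] at this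
  split_ifs at this with h1
  obtain ⟨z, hz, rfl⟩ := Option.map_eq_some_iff.1 this.symm
  exact ⟨h1, z, rfl, eq_of_remove hz⟩

theorem mul_left_cancel' {u x y : TraceMonoid I} (h : u * x = u * y) : x = y := by
  induction u using induction_on with
  | one => simpa using h
  | of_mul a u ih => exact ih (of_mul_cancel (by simpa [mul_assoc] using h))

theorem le_mul_right' (x y : TraceMonoid I) : x ≤ x * y := ⟨y, rfl⟩

theorem one_le' (x : TraceMonoid I) : 1 ≤ x := ⟨x, (one_mul x).symm⟩

theorem mul_le_mul_iff {u x y : TraceMonoid I} : u * x ≤ u * y ↔ x ≤ y := by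
  constructor
  · rintro ⟨z, hz⟩
    exact ⟨z, mul_left_cancel' (by rw [hz, mul_assoc])⟩
  · rintro ⟨z, rfl⟩
    exact ⟨z, (mul_assoc _ _ _).symm⟩

theorem exists_of_mul {x : TraceMonoid I} (h : x ≠ 1) : ∃ a y, x = of I a * y := by
  induction x using induction_on with
  | one => exact absurd rfl h
  | of_mul a x _ => exact ⟨a, x, rfl⟩

theorem of_mul_ne_one (a : A) (x : TraceMonoid I) : of I a * x ≠ 1 := fun h => by
  have := congrArg length h
  rw [length_mul, length_of, length_one] at this
  omega

/-- A divisor of `a t` that does not start with `a` commutes with `a` and divides `t`. -/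
theorem le_and_commute_of_le_of_mul {a : A} {y t : TraceMonoid I} (ha : ¬ of I a ≤ y)
    (h : y ≤ of I a * t) : y ≤ t ∧ Commute (of I a) y := by
  induction y using induction_on generalizing t with
  | one => exact ⟨one_le' _, Commute.one_right _⟩
  | of_mul b y ih =>
    have hab : a ≠ b := by rintro rfl; exact ha (le_mul_right' _ _)
    obtain ⟨s, hs⟩ := h
    rw [mul_assoc] at hs
    obtain ⟨hadj, z, rfl, hz⟩ := levi hab hs
    have hay : ¬ of I a ≤ y := by
      rintro ⟨q, rfl⟩
      exact ha ⟨of I b * q, by rw [← mul_assoc, ← mul_assoc, (of_commute hadj).eq]⟩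
    obtain ⟨h1, h2⟩ := ih hay ⟨s, hz.symm⟩
    exact ⟨mul_le_mul_iff.2 h1, (of_commute hadj).mul_right h2⟩

/-- A letter dividing `u x` divides `u`, or commutes with `u` and divides `x`. -/
theorem of_le_mul {a : A} {u x : TraceMonoid I} (h : of I a ≤ u * x) (hu : ¬ of I a ≤ u) :
    Commute (of I a) u ∧ of I a ≤ x := by
  obtain ⟨t, ht⟩ := h
  obtain ⟨⟨s, rfl⟩, h2⟩ := le_and_commute_of_le_of_mul hu ⟨x, ht.symm⟩
  refine ⟨h2, s, mul_left_cancel' (u := u) ?_⟩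
  rw [ht, ← mul_assoc, h2.eq, mul_assoc]

theorem adj_of_commute {a b : A} (hab : a ≠ b) {y : TraceMonoid I}
    (h : Commute (of I a) (of I b * y)) : I.Adj a b := by
  have := h.eq
  rw [mul_assoc] at this
  exact (levi hab this).1

/-- Divisors of a product factor along the product. -/
theorem exists_mul_of_le_mul {y u v : TraceMonoid I} (h : y ≤ u * v) :
    ∃ u' v', u' ≤ u ∧ v' ≤ v ∧ y = u' * v' := by
  induction y using induction_on generalizing u v with
  | one => exact ⟨1, 1, one_le' _, one_le' _, (one_mul 1).symm⟩
  | of_mul a y ih =>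
    by_cases hau : of I a ≤ u
    · obtain ⟨u, rfl⟩ := hau
      rw [mul_assoc, mul_le_mul_iff] at h
      obtain ⟨u', v', h1, h2, rfl⟩ := ih h
      exact ⟨of I a * u', v', mul_le_mul_iff.2 h1, h2, (mul_assoc _ _ _).symm⟩
    · obtain ⟨hc, v, rfl⟩ := of_le_mul ((le_mul_right' _ _).trans h) hau
      rw [← mul_assoc, ← hc.eq, mul_assoc, mul_le_mul_iff] at h
      obtain ⟨u', v', ⟨s, rfl⟩, h2, rfl⟩ := ih h
      have hau' : ¬ of I a ≤ u' := fun hh => hau (hh.trans (le_mul_right' _ _))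
      -- Since `a` commutes with `u' s`, one has `a u' s = u' s a`; so `u'` divides it without
      -- starting with `a`, and must commute with `a`.
      have hc' := (le_and_commute_of_le_of_mul (t := u' * s) hau' ⟨s * of I a, by
        rw [hc.eq, mul_assoc]⟩).2
      exact ⟨u', of I a * v', le_mul_right' _ _, mul_le_mul_iff.2 h2, by
        rw [← mul_assoc, hc'.eq, mul_assoc]⟩

/-- Two traces with a common upper bound have a least upper bound. -/
theorem exists_isLUB {x y z : TraceMonoid I} (hx : x ≤ z) (hy : y ≤ z) :
    ∃ w, IsLUB {x, y} w := by
  suffices h : ∃ w, x ≤ w ∧ y ≤ w ∧ ∀ t, x ≤ t → y ≤ t → w ≤ t by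
    obtain ⟨w, h1, h2, h3⟩ := h
    refine ⟨w, ?_, fun t ht => h3 t (ht (by simp)) (ht (by simp))⟩
    rintro _ (rfl | rfl)
    exacts [h1, h2]
  induction x using induction_on generalizing y z with
  | one => exact ⟨y, one_le' _, le_rfl, fun _ _ h => h⟩
  | of_mul a x ih =>
    obtain ⟨z, rfl⟩ := (le_mul_right' _ _).trans hx
    rw [mul_le_mul_iff] at hx
    by_cases hay : of I a ≤ y
    · obtain ⟨y, rfl⟩ := hay
      rw [mul_le_mul_iff] at hy
      obtain ⟨w, h1, h2, h3⟩ := ih hx hy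
      refine ⟨of I a * w, mul_le_mul_iff.2 h1, mul_le_mul_iff.2 h2, fun t ht1 ht2 => ?_⟩
      obtain ⟨t, rfl⟩ := (le_mul_right' _ _).trans ht1
      exact mul_le_mul_iff.2 (h3 t (mul_le_mul_iff.1 ht1) (mul_le_mul_iff.1 ht2))
    · obtain ⟨hyz, hc⟩ := le_and_commute_of_le_of_mul hay hy
      obtain ⟨w, h1, ⟨s, rfl⟩, h3⟩ := ih hx hyz
      -- As `a` commutes with `y` and does not divide it, the supremum of `a x` and `y` is `a` times
      -- that of `x` and `y`.
      refine ⟨of I a * (y * s), mul_le_mul_iff.2 h1, ⟨of I a * s, ?_⟩, fun t ht1 ht2 => ?_⟩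
      · rw [← mul_assoc, hc.eq, mul_assoc]
      · obtain ⟨t, rfl⟩ := (le_mul_right' _ _).trans ht1
        exact mul_le_mul_iff.2
          (h3 t (mul_le_mul_iff.1 ht1) (le_and_commute_of_le_of_mul hay ht2).1)

/-- The reversal of traces. -/
def revHom (I : SimpleGraph A) : TraceMonoid I →* (TraceMonoid I)ᵐᵒᵖ :=
  PresentedMonoid.lift (fun a => MulOpposite.op (of I a)) (by
    rintro _ _ ⟨a, b, h, rfl, rfl⟩
    simp only [map_mul, FreeMonoid.lift_eval_of, ← MulOpposite.op_mul, (of_commute h).eq])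

/-- The reversal of a trace. -/
def rev (x : TraceMonoid I) : TraceMonoid I := (revHom I x).unop

theorem rev_mul (x y : TraceMonoid I) : rev (x * y) = rev y * rev x := by
  simp [rev]

theorem rev_one : rev (1 : TraceMonoid I) = 1 := by simp [rev]

theorem rev_of (a : A) : rev (of I a) = of I a := by
  have : revHom I (of I a) = MulOpposite.op (of I a) := PresentedMonoid.lift_of _ _
  rw [rev, this, MulOpposite.unop_op]

theorem rev_rev (x : TraceMonoid I) : rev (rev x) = x := by
  induction x using induction_on with
  | one => rw [rev_one, rev_one]
  | of_mul a x ih => rw [rev_mul, rev_mul, ih, rev_of, rev_of]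

/-- Reversal exchanges left and right cancellation. -/
theorem mul_right_cancel' {u x y : TraceMonoid I} (h : x * u = y * u) : x = y := by
  have := congrArg rev h
  rw [rev_mul, rev_mul] at this
  rw [← rev_rev x, mul_left_cancel' this, rev_rev]

instance [Countable A] : Countable (TraceMonoid I) :=
  haveI : Countable (FreeMonoid A) := inferInstanceAs (Countable (List A))
  (PresentedMonoid.surjective_mk (rels := fun u v : FreeMonoid A =>
    ∃ a b : A, I.Adj a b ∧ u = FreeMonoid.of a * FreeMonoid.of b ∧
      v = FreeMonoid.of b * FreeMonoid.of a)).countable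

end TraceMonoid

/-! ### Cliques as traces -/

namespace Clique

variable {A : Type*} {I : SimpleGraph A}

@[ext] theorem ext' {c d : Clique I} (h : ∀ a, a ∈ c.1 ↔ a ∈ d.1) : c = d :=
  Subtype.ext (Finset.ext h)

theorem toTrace_empty : (Clique.empty I).toTrace = 1 := by
  simp [toTrace, empty]

open Classical in
/-- A clique without one of its letters. -/
def erase (c : Clique I) (a : A) : Clique I :=
  ⟨c.1.erase a, c.2.subset (by simp)⟩

theorem of_mul_erase {c : Clique I} {a : A} (h : a ∈ c.1) :
    of I a * (c.erase a).toTrace = c.toTrace := by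
  classical
  exact Finset.mul_noncommProd_erase c.1 h (of I) c.pairwise_commute

theorem mem_erase {c : Clique I} {a b : A} : b ∈ (c.erase a).1 ↔ b ≠ a ∧ b ∈ c.1 := by
  simp [erase]

theorem card_erase_lt {c : Clique I} {a : A} (h : a ∈ c.1) :
    (c.erase a).1.card < c.1.card := by
  classical
  simp only [erase]
  convert Finset.card_erase_lt_of_mem h

/-- The cliques with one letter. -/
def single (I : SimpleGraph A) (a : A) : Clique I := ⟨{a}, by simp⟩

theorem toTrace_single (a : A) : (single I a).toTrace = of I a := by
  simp [toTrace, single]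

/-- Induction on cliques by removal of a letter. -/
theorem induction_erase {p : Clique I → Prop} (c : Clique I) (h0 : p (Clique.empty I))
    (h : ∀ (c : Clique I) (a : A), a ∈ c.1 → p (c.erase a) → p c) : p c := by
  induction hn : c.1.card using Nat.strong_induction_on generalizing c with
  | _ n ih =>
    by_cases hc : c.1.Nonempty
    · obtain ⟨a, ha⟩ := hc
      exact h c a ha (ih _ (hn ▸ card_erase_lt ha) _ rfl)
    · have : c = Clique.empty I := Subtype.ext (Finset.not_nonempty_iff_eq_empty.1 hc)
      exact this ▸ h0

/-- By Levi's lemma, removing one leading letter leaves the other leading letters in place, so the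
letters of `c` can be extracted one by one. -/
theorem toTrace_le_iff {c : Clique I} {y : TraceMonoid I} :
    c.toTrace ≤ y ↔ ∀ a ∈ c.1, of I a ≤ y := by
  constructor
  · intro h a ha
    rw [← of_mul_erase ha] at h
    exact (le_mul_right' _ _).trans h
  · induction c using induction_erase generalizing y with
    | h0 => rw [toTrace_empty]; exact fun _ => one_le' _
    | h c a ha ih =>
      intro h
      obtain ⟨y, rfl⟩ := h a ha
      rw [← of_mul_erase ha, mul_le_mul_iff]
      refine ih fun b hb => ?_
      obtain ⟨hba, hb⟩ := mem_erase.1 hb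
      obtain ⟨t, ht⟩ := h b hb
      obtain ⟨-, z, rfl, -⟩ := levi hba.symm ht
      exact le_mul_right' _ _

theorem of_le_toTrace_iff {c : Clique I} {a : A} : of I a ≤ c.toTrace ↔ a ∈ c.1 := by
  refine ⟨fun h => ?_, fun h => toTrace_le_iff.1 le_rfl a h⟩
  induction c using induction_erase with
  | h0 =>
    rw [toTrace_empty] at h
    obtain ⟨t, ht⟩ := h
    exact absurd ht.symm (of_mul_ne_one _ _)
  | h c b hb ih =>
    by_cases hab : a = b
    · exact hab ▸ hb
    · rw [← of_mul_erase hb] at h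
      obtain ⟨t, ht⟩ := h
      obtain ⟨-, z, hz, -⟩ := levi (Ne.symm hab) ht
      exact (mem_erase.1 (ih ⟨z, hz⟩)).2

theorem toTrace_injective : Function.Injective (toTrace (I := I)) := fun c d h => by
  ext a
  rw [← of_le_toTrace_iff, h, of_le_toTrace_iff]

theorem adj_of_commute {c : Clique I} {a : A} (ha : a ∉ c.1)
    (h : Commute (of I a) c.toTrace) : ∀ b ∈ c.1, I.Adj a b := by
  intro b hb
  rw [← of_mul_erase hb] at h
  exact TraceMonoid.adj_of_commute (by rintro rfl; exact ha hb) h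

theorem commute_of_adj {c : Clique I} {a : A} (h : ∀ b ∈ c.1, I.Adj a b) :
    Commute (of I a) c.toTrace := by
  rw [toTrace]
  exact Finset.noncommProd_commute _ _ _ _ fun b hb => of_commute (h b hb)

/-- Divisors of cliques are cliques. -/
theorem exists_eq_of_le {c : Clique I} {y : TraceMonoid I} (h : y ≤ c.toTrace) :
    ∃ d : Clique I, d ≤ c ∧ y = d.toTrace := by
  induction y using TraceMonoid.induction_on generalizing c with
  | one => exact ⟨Clique.empty I, Finset.empty_subset c.1, toTrace_empty.symm⟩
  | of_mul a y ih =>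
    have ha : a ∈ c.1 := of_le_toTrace_iff.1 ((le_mul_right' _ _).trans h)
    rw [← of_mul_erase ha, mul_le_mul_iff] at h
    obtain ⟨d, hd, rfl⟩ := ih h
    classical
    have hins : ∀ b ∈ d.1, b ≠ a ∧ b ∈ c.1 := fun b hb => mem_erase.1 (hd hb)
    have hsub : insert a d.1 ⊆ c.1 :=
      Finset.insert_subset ha fun b hb => (hins b hb).2
    obtain ⟨e, he⟩ : ∃ e : Clique I, e.1 = insert a d.1 :=
      ⟨⟨_, c.2.subset (Finset.coe_subset.2 hsub)⟩, rfl⟩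
    refine ⟨e, fun b hb => hsub (he ▸ hb), ?_⟩
    · rw [← of_mul_erase (c := e) (a := a) (by simp [he])]
      congr 2
      ext b
      rw [mem_erase]
      simp only [he, Finset.mem_insert]
      constructor
      · exact fun hb => ⟨(hins b hb).1, Or.inr hb⟩
      · rintro ⟨h1, h2 | h2⟩
        exacts [absurd h2 h1, h2]

/-- Two cliques are parallel if all letters of the one are independent of those of the other. -/
def Parallel (c d : Clique I) : Prop := ∀ a ∈ c.1, ∀ b ∈ d.1, I.Adj a b

theorem Parallel.disjoint {c d : Clique I} (h : c.Parallel d) : Disjoint c.1 d.1 :=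
  Finset.disjoint_left.2 fun _ h1 h2 => (h _ h1 _ h2).ne rfl

open Classical in
/-- The union of two parallel cliques. -/
def union (c d : Clique I) (h : c.Parallel d) : Clique I :=
  ⟨c.1 ∪ d.1, by
    intro a ha b hb hab
    simp only [Finset.coe_union, Set.mem_union, Finset.mem_coe] at ha hb
    rcases ha with ha | ha <;> rcases hb with hb | hb
    · exact c.2 ha hb hab
    · exact h _ ha _ hb
    · exact (h _ hb _ ha).symm
    · exact d.2 ha hb hab⟩

theorem mem_union {c d : Clique I} (h : c.Parallel d) {a : A} :
    a ∈ (c.union d h).1 ↔ a ∈ c.1 ∨ a ∈ d.1 := by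
  simp [union]

theorem toTrace_union {c d : Clique I} (h : c.Parallel d) :
    (c.union d h).toTrace = c.toTrace * d.toTrace := by
  classical
  exact Finset.noncommProd_union_of_disjoint h.disjoint (of I) (union c d h).pairwise_commute

theorem card_union {c d : Clique I} (h : c.Parallel d) :
    (c.union d h).1.card = c.1.card + d.1.card := by
  classical
  simp only [union]
  convert Finset.card_union_of_disjoint h.disjoint

theorem rev_toTrace (c : Clique I) : rev c.toTrace = c.toTrace := by
  induction c using induction_erase with
  | h0 => rw [toTrace_empty, rev_one]
  | h c a ha ih =>
    rw [← of_mul_erase ha, rev_mul, ih, rev_of]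
    exact (commute_of_adj fun b hb =>
      c.2 ha (mem_erase.1 hb).2 (mem_erase.1 hb).1.symm).eq.symm

end Clique

/-! ### Products of a bounded number of cliques -/

namespace TraceMonoid

variable {A : Type*} {I : SimpleGraph A}

/-- The traces that are products of `n` cliques. -/
def cliqueProducts (I : SimpleGraph A) (n : ℕ) : Set (TraceMonoid I) :=
  Set.range (Clique.toTrace (I := I)) ^ n

theorem cliqueProducts_succ (n : ℕ) :
    cliqueProducts I (n + 1) = cliqueProducts I n * Set.range (Clique.toTrace (I := I)) :=
  pow_succ _ _

theorem cliqueProducts_succ' (n : ℕ) :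
    cliqueProducts I (n + 1) = Set.range (Clique.toTrace (I := I)) * cliqueProducts I n :=
  pow_succ' _ _

theorem finite_cliqueProducts [Finite A] (n : ℕ) : (cliqueProducts I n).Finite := by
  induction n with
  | zero => rw [cliqueProducts, pow_zero]; exact Set.finite_one
  | succ n ih => rw [cliqueProducts_succ]; exact ih.mul (Set.finite_range _)

/-- Empty factors are allowed, so `cliqueProducts I n` bounds the height by `n` instead of fixing
it. -/
theorem one_mem_range : (1 : TraceMonoid I) ∈ Set.range (Clique.toTrace (I := I)) :=
  ⟨Clique.empty I, Clique.toTrace_empty⟩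

theorem cliqueProducts_mono : Monotone (cliqueProducts I) :=
  fun _ _ h => Set.pow_subset_pow_right one_mem_range h

/-- A divisor of a product splits along the factors, and divisors of cliques are cliques. This
closure permits Möbius inversion inside the truncated set. -/
theorem mem_cliqueProducts_of_le {n : ℕ} {x y : TraceMonoid I} (h : x ≤ y)
    (hy : y ∈ cliqueProducts I n) : x ∈ cliqueProducts I n := by
  induction n generalizing x y with
  | zero =>
    rw [cliqueProducts, pow_zero, Set.mem_one] at hy ⊢
    exact le_antisymm (hy ▸ h) (one_le' x)
  | succ n ih =>
    rw [cliqueProducts_succ] at hy ⊢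
    obtain ⟨y, hy, _, ⟨c, rfl⟩, rfl⟩ := hy
    obtain ⟨u, v, hu, hv, rfl⟩ := exists_mul_of_le_mul h
    obtain ⟨d, -, rfl⟩ := Clique.exists_eq_of_le hv
    exact ⟨u, ih hu hy, _, ⟨d, rfl⟩, rfl⟩

theorem mem_cliqueProducts_length (x : TraceMonoid I) : x ∈ cliqueProducts I x.length := by
  induction x using induction_on with
  | one => rw [length_one, cliqueProducts, pow_zero]; rfl
  | of_mul a x ih =>
    rw [length_mul, length_of, add_comm, cliqueProducts_succ']
    exact ⟨_, ⟨_, Clique.toTrace_single a⟩, x, ih, rfl⟩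

end TraceMonoid

/-! ### Cartier-Foata normal form -/

section CartierFoata

variable {A : Type*} {I : SimpleGraph A}

theorem partialProd_succ (c : ℕ → NonemptyClique I) (n : ℕ) :
    partialProd c (n + 1) = partialProd c n * (c n).toTrace := rfl

theorem partialProd_succ' (c : ℕ → NonemptyClique I) (n : ℕ) :
    partialProd c (n + 1) = (c 0).toTrace * partialProd (fun i => c (i + 1)) n := by
  induction n with
  | zero => simp [partialProd]
  | succ n ih => rw [partialProd, ih, partialProd, mul_assoc]

theorem partialProd_congr {c d : ℕ → NonemptyClique I} {n : ℕ} (h : ∀ i < n, c i = d i) :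
    partialProd c n = partialProd d n := by
  induction n with
  | zero => rfl
  | succ n ih => rw [partialProd, partialProd, ih fun i hi => h i (by omega), h n (by omega)]

theorem partialProd_mem_cliqueProducts (c : ℕ → NonemptyClique I) (n : ℕ) :
    partialProd c n ∈ cliqueProducts I n := by
  induction n with
  | zero => rw [cliqueProducts, pow_zero]; rfl
  | succ n ih => rw [cliqueProducts_succ]; exact ⟨_, ih, _, ⟨_, rfl⟩, rfl⟩

/-- The first `n + 1` cliques of the sequence are in Cartier-Foata normal form. -/
def IsNormal (c : ℕ → NonemptyClique I) (n : ℕ) : Prop :=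
  ∀ i < n, (c i).CartierFoata (c (i + 1))

theorem IsNormal.tail {c : ℕ → NonemptyClique I} {n : ℕ} (h : IsNormal c (n + 1)) :
    IsNormal (fun i => c (i + 1)) n := fun i hi => h (i + 1) (by omega)

/-- A leading letter outside `c 0` would commute with `c 0` and lead the tail, hence lie in `c 1` by
induction; but `c 0 → c 1` blocks it. -/
theorem IsNormal.mem_of_le {c : ℕ → NonemptyClique I} {n : ℕ} (h : IsNormal c n) {a : A}
    (ha : of I a ≤ partialProd c (n + 1)) : a ∈ (c 0).1.1 := by
  induction n generalizing c with
  | zero =>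
    rw [partialProd, partialProd, one_mul] at ha
    exact Clique.of_le_toTrace_iff.1 ha
  | succ n ih =>
    by_contra hc
    rw [partialProd_succ'] at ha
    obtain ⟨h1, h2⟩ := of_le_mul ha fun h' => hc (Clique.of_le_toTrace_iff.1 h')
    obtain ⟨b, hb, hb'⟩ := h 0 (by omega) a (ih h.tail h2)
    exact hb' (Clique.adj_of_commute hc h1 b hb).symm

theorem of_le_partialProd {c : ℕ → NonemptyClique I} {n : ℕ} {a : A} (ha : a ∈ (c 0).1.1) :
    of I a ≤ partialProd c (n + 1) := by
  rw [partialProd_succ']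
  exact (Clique.of_le_toTrace_iff.2 ha).trans (le_mul_right' _ _)

/-- The first clique is the set of leading letters of the product; cancel it and induct. -/
theorem IsNormal.unique {c d : ℕ → NonemptyClique I} {n : ℕ} (hc : IsNormal c n)
    (hd : IsNormal d n) (h : partialProd c (n + 1) = partialProd d (n + 1)) :
    ∀ i ≤ n, c i = d i := by
  induction n generalizing c d with
  | zero =>
    intro i hi
    obtain rfl : i = 0 := by omega
    rw [partialProd, partialProd, partialProd, partialProd, one_mul, one_mul] at h
    exact Subtype.ext (Clique.toTrace_injective h)
  | succ n ih =>
    have h0 : c 0 = d 0 := by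
      refine Subtype.ext (Clique.ext' fun a => ⟨fun ha => ?_, fun ha => ?_⟩)
      · exact hd.mem_of_le (h ▸ of_le_partialProd ha)
      · exact hc.mem_of_le (h ▸ of_le_partialProd ha)
    rw [partialProd_succ', partialProd_succ' d, h0] at h
    intro i hi
    cases i with
    | zero => exact h0
    | succ i => exact ih hc.tail hd.tail (mul_left_cancel' h) i (by omega)

/-- The first of the supposed `n` cliques divides `u c₀`: each of its letters divides `u`, or
commutes with `u` and lies in `c₀`. The arbitrary factor `u` drives the induction, since the rest of
`u c₀` is the left factor for the tail. -/
theorem IsNormal.mul_notMem {c : ℕ → NonemptyClique I} {n : ℕ} (hc : IsNormal c n)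
    (u : TraceMonoid I) : u * partialProd c (n + 1) ∉ cliqueProducts I n := by
  induction n generalizing c u with
  | zero =>
    intro h
    rw [cliqueProducts, pow_zero, Set.mem_one] at h
    have h1 := congrArg length h
    have h2 := le_length_partialProd c 1
    rw [length_mul, length_one, zero_add] at h1
    omega
  | succ n ih =>
    intro h
    rw [cliqueProducts_succ'] at h
    obtain ⟨_, ⟨d, rfl⟩, w, hw, hdw⟩ := h
    have hd : d.toTrace ≤ u * (c 0).toTrace := by
      refine Clique.toTrace_le_iff.2 fun a ha => ?_
      have h1 : of I a ≤ u * partialProd c (n + 1 + 1) :=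
        (Clique.of_le_toTrace_iff.2 ha).trans ⟨w, hdw.symm⟩
      by_cases hau : of I a ≤ u
      · exact hau.trans (le_mul_right' _ _)
      · obtain ⟨h2, h3⟩ := of_le_mul h1 hau
        obtain ⟨t, ht⟩ := Clique.of_le_toTrace_iff.2 (hc.mem_of_le h3)
        exact ⟨u * t, by rw [NonemptyClique.toTrace, ht, ← mul_assoc, ← h2.eq, mul_assoc]⟩
    obtain ⟨e, he⟩ := hd
    refine ih hc.tail e ?_
    rw [partialProd_succ', ← mul_assoc, he, mul_assoc] at hdw
    exact mul_left_cancel' hdw ▸ hw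

open Classical in
/-- The set of leading letters of a trace is a clique. -/
theorem exists_leading_clique [Finite A] (x : TraceMonoid I) :
    ∃ c : Clique I, ∀ a, a ∈ c.1 ↔ of I a ≤ x := by
  have := Fintype.ofFinite A
  refine ⟨⟨Finset.univ.filter fun a => of I a ≤ x, fun a ha b hb hab => ?_⟩, fun a => by simp⟩
  obtain ⟨y, hy⟩ := (Finset.mem_filter.1 ha).2
  obtain ⟨z, hz⟩ := (Finset.mem_filter.1 hb).2
  exact (levi hab (hy.symm.trans hz)).1

theorem exists_isNormal [Finite A] {x : TraceMonoid I} (hx : x ≠ 1) :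
    ∃ n c, IsNormal c n ∧ x = partialProd c (n + 1) := by
  induction hl : x.length using Nat.strong_induction_on generalizing x with
  | _ l ih =>
    obtain ⟨c, hc⟩ := exists_leading_clique x
    obtain ⟨y, rfl⟩ := Clique.toTrace_le_iff.2 fun a ha => (hc a).1 ha
    have hne : c.1.Nonempty := by
      obtain ⟨a, z, hz⟩ := exists_of_mul hx
      exact ⟨a, (hc a).2 ⟨z, hz⟩⟩
    by_cases hy : y = 1
    · subst hy
      exact ⟨0, fun _ => ⟨c, hne⟩, fun i hi => absurd hi (by omega),
        by simp [partialProd, NonemptyClique.toTrace]⟩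
    · rw [length_mul, Clique.length_toTrace] at hl
      have := Finset.card_pos.2 hne
      obtain ⟨n, d, hd, rfl⟩ := ih y.length (by omega) hy rfl
      refine ⟨n + 1, fun i => Nat.casesOn i ⟨c, hne⟩ d, ?_, ?_⟩
      · rintro (_ | i) hi
        · intro b hb
          -- A letter `b` independent of all of `c` would lead the whole trace, hence belong to `c`
          -- and be independent of itself.
          by_contra! hb'
          have hcb : Commute (of I b) c.toTrace :=
            Clique.commute_of_adj fun a ha => (hb' a ha).symm
          obtain ⟨t, ht⟩ := of_le_partialProd (n := n) hb
          have hbc : b ∈ c.1 := (hc b).2 ⟨c.toTrace * t, by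
            rw [ht, ← mul_assoc, ← hcb.eq, mul_assoc]⟩
          exact (hb' b hbc).ne rfl
        · exact hd i (by omega)
      · exact (partialProd_succ' (fun i => Nat.casesOn i ⟨c, hne⟩ d) (n + 1)).symm

/-- A product of `n + 1` cliques is a product of `n` cliques or has a normal form made of `n + 1`
non empty cliques. -/
theorem exists_isNormal_of_mem [Finite A] {n : ℕ} {x : TraceMonoid I}
    (hx : x ∈ cliqueProducts I (n + 1)) (hx' : x ∉ cliqueProducts I n) :
    ∃ c, IsNormal c n ∧ x = partialProd c (n + 1) := by
  have h1 : x ≠ 1 := by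
    rintro rfl
    exact hx' (cliqueProducts_mono (Nat.zero_le n) (by rw [cliqueProducts, pow_zero]; rfl))
  obtain ⟨m, c, hc, rfl⟩ := exists_isNormal h1
  obtain rfl : m = n := by
    apply le_antisymm
    · by_contra! h
      refine hc.mul_notMem 1 ?_
      rw [one_mul]
      exact cliqueProducts_mono (by omega : n + 1 ≤ m) hx
    · by_contra! h
      exact hx' (cliqueProducts_mono (by omega) (partialProd_mem_cliqueProducts c (m + 1)))
  exact ⟨c, hc, rfl⟩

/-- If a letter `b` of `d` is blocked by `c n`, then `c 0 → ⋯ → c n → {b}` is a normal form of `n +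
2` cliques dividing the product, which is too high. If none is, `d` merges into `c n`. -/
theorem IsNormal.mul_mem_iff {c : ℕ → NonemptyClique I} {n : ℕ} (hc : IsNormal c n)
    (d : Clique I) :
    partialProd c (n + 1) * d.toTrace ∈ cliqueProducts I (n + 1) ↔ (c n).1.Parallel d := by
  constructor
  · intro h a ha b hb
    by_contra hab
    let e : ℕ → NonemptyClique I := fun i =>
      if i ≤ n then c i else ⟨Clique.single I b, Finset.singleton_nonempty b⟩
    have he : IsNormal e (n + 1) := by
      intro i hi
      rcases Nat.lt_succ_iff_lt_or_eq.1 hi with hi' | rfl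
      · simpa [e, hi'.le, Nat.succ_le_of_lt hi'] using hc i hi'
      · simp only [e, le_refl, add_le_iff_nonpos_right, Nat.le_zero, one_ne_zero]
        intro b' hb'
        obtain rfl := Finset.mem_singleton.1 hb'
        exact ⟨a, ha, hab⟩
    refine he.mul_notMem 1 (mem_cliqueProducts_of_le ?_ h)
    have h1 : partialProd e (n + 1) = partialProd c (n + 1) :=
      partialProd_congr fun i hi => if_pos (by omega)
    have h2 : (e (n + 1)).toTrace = of I b := by
      simp [e, NonemptyClique.toTrace, Clique.toTrace_single]
    rw [one_mul, partialProd, h1, h2, mul_le_mul_iff]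
    exact Clique.of_le_toTrace_iff.2 hb
  · intro h
    rw [cliqueProducts_succ, partialProd, mul_assoc]
    exact ⟨_, partialProd_mem_cliqueProducts c n, _, ⟨_, Clique.toTrace_union h⟩, rfl⟩

end CartierFoata

/-! ### Möbius inversion -/

section Sums

variable {A : Type*} [Finite A] {I : SimpleGraph A}

-- The cliques in the sum are the subsets of `{a ∈ c | p a}`, so this is the usual alternating sum
-- over a powerset.
open Classical in
theorem sum_neg_one_pow_card_le (c : Clique I) (p : A → Prop) (q : Clique I → Prop)
    [DecidablePred q] (hq : ∀ d, q d ↔ d ≤ c ∧ ∀ a ∈ d.1, p a) (r : Prop) [Decidable r]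
    (hr : r ↔ ∀ a ∈ c.1, ¬ p a) :
    ∑ d : Clique I with q d, (-1 : ℝ) ^ d.1.card = if r then 1 else 0 := by
  have h1 : ∑ d : Clique I with q d, (-1 : ℝ) ^ d.1.card =
      ∑ s ∈ (c.1.filter p).powerset, (-1 : ℝ) ^ s.card := by
    refine Finset.sum_bij (fun d _ => d.1) ?_ ?_ ?_ ?_
    · intro d hd
      obtain ⟨h1, h2⟩ := (hq d).1 (Finset.mem_filter.1 hd).2
      exact Finset.mem_powerset.2 fun a ha => Finset.mem_filter.2 ⟨h1 ha, h2 a ha⟩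
    · exact fun d _ e _ h => Subtype.ext h
    · intro s hs
      have hs' := Finset.mem_powerset.1 hs
      refine ⟨⟨s, c.2.subset fun a ha => (Finset.mem_filter.1 (hs' ha)).1⟩, ?_, rfl⟩
      exact Finset.mem_filter.2 ⟨Finset.mem_univ _, (hq _).2
        ⟨fun a ha => (Finset.mem_filter.1 (hs' ha)).1,
        fun a ha => (Finset.mem_filter.1 (hs' ha)).2⟩⟩
    · exact fun _ _ => rfl
  rw [h1]
  have h2 := Finset.sum_powerset_neg_one_pow_card (x := c.1.filter p)
  simp only [Finset.filter_eq_empty_iff, ← hr] at h2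
  have h3 := congrArg (Int.cast : ℤ → ℝ) h2
  push_cast at h3
  rw [h3]

-- After exchanging sums, the coefficient of `φ(c')` is an alternating sum over subsets of `{a ∈ c'
-- | ¬ p a}`, zero unless that set is empty. Taking `p` to be independence from `γ` computes `g`;
-- taking `p` false gives total mass `1`.
open Classical in
theorem sum_moebiusTransform (φ : TraceMonoid I → ℝ) (p : A → Prop) (q r : Clique I → Prop)
    [DecidablePred q] [DecidablePred r] (hq : ∀ c, q c ↔ ∀ a ∈ c.1, ¬ p a)
    (hr : ∀ c, r c ↔ ∀ a ∈ c.1, p a) :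
    ∑ c : Clique I with q c, moebiusTransform φ c =
      ∑ d : Clique I with r d, (-1 : ℝ) ^ d.1.card * φ d.toTrace := by
  simp only [moebiusTransform, Finset.sum_filter]
  have hcomm : ∀ c : Clique I, (if q c then ∑ c' : Clique I,
      (if c ≤ c' then (-1 : ℝ) ^ (c'.1.card - c.1.card) * φ c'.toTrace else 0) else 0) =
      ∑ c' : Clique I, (-1 : ℝ) ^ c'.1.card * φ c'.toTrace *
        (if c ≤ c' ∧ q c then (-1 : ℝ) ^ c.1.card else 0) := by
    intro c
    split_ifs with h
    · refine Finset.sum_congr rfl fun c' _ => ?_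
      by_cases hc : c ≤ c'
      · rw [if_pos hc, if_pos ⟨hc, h⟩]
        obtain ⟨k, hk⟩ := Nat.exists_eq_add_of_le (Finset.card_le_card hc)
        rw [hk, Nat.add_sub_cancel_left, pow_add]
        have : (-1 : ℝ) ^ c.1.card * (-1 : ℝ) ^ c.1.card = 1 := by
          rw [← mul_pow]; simp
        linear_combination (-(-1 : ℝ) ^ k * φ c'.toTrace) * this
      · rw [if_neg hc, if_neg fun h' => hc h'.1, mul_zero]
    · simp [h]
  rw [Finset.sum_congr rfl fun c _ => hcomm c, Finset.sum_comm]
  refine Finset.sum_congr rfl fun c' _ => ?_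
  rw [← Finset.mul_sum, ← Finset.sum_filter,
    sum_neg_one_pow_card_le c' (fun a => ¬ p a) _ (fun c => by rw [hq]) (r c')
      (by simp only [hr, not_not])]
  simp

-- Used with `φ = h_α`, whose vanishing at the empty clique lets sums over non-empty cliques be
-- taken over all cliques.
open Classical in
theorem sum_nonemptyClique (φ : Clique I → ℝ) (q : NonemptyClique I → Prop)
    (p : Clique I → Prop) [DecidablePred q] [DecidablePred p] (hqp : ∀ c, q c ↔ p c.1)
    (h : φ (Clique.empty I) = 0) :
    ∑ c : NonemptyClique I with q c, φ c.1 = ∑ c : Clique I with p c, φ c := by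
  rw [Finset.sum_filter, Finset.sum_filter]
  simp only [hqp]
  refine Finset.sum_bij_ne_zero (fun c _ _ => c.1) (fun _ _ _ => Finset.mem_univ _)
    (fun _ _ _ _ _ _ => Subtype.ext) (fun c _ hc => ?_) (fun _ _ _ => rfl)
  by_cases hne : c.1.Nonempty
  · exact ⟨⟨c, hne⟩, Finset.mem_univ _, hc, rfl⟩
  · have : c = Clique.empty I := Subtype.ext (Finset.not_nonempty_iff_eq_empty.1 hne)
    rw [this, h] at hc
    simp at hc

open Classical in
/-- Möbius inversion for right divisors that are cliques. -/
theorem sum_neg_one_pow_card_right_divisor (w : TraceMonoid I) :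
    ∑ d : Clique I with ∃ v, w = v * d.toTrace, (-1 : ℝ) ^ d.1.card = if w = 1 then 1 else 0 := by
  -- Reversal fixes cliques, so the right divisors of `w` that are cliques are the subsets of the
  -- set of leading letters of `rev w`.
  obtain ⟨c, hc⟩ := exists_leading_clique (rev w)
  have h1 : ∀ d : Clique I, (∃ v, w = v * d.toTrace) ↔ d ≤ c ∧ ∀ a ∈ d.1, True := by
    intro d
    have : (∃ v, w = v * d.toTrace) ↔ d.toTrace ≤ rev w := by
      constructor
      · rintro ⟨v, rfl⟩
        exact ⟨rev v, by rw [rev_mul, Clique.rev_toTrace]⟩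
      · rintro ⟨v, hv⟩
        exact ⟨rev v, by rw [← rev_rev w, hv, rev_mul, Clique.rev_toTrace]⟩
    rw [this, Clique.toTrace_le_iff]
    simp only [implies_true, and_true]
    exact ⟨fun h a ha => (hc a).2 (h a ha), fun h a ha => (hc a).1 (h ha)⟩
  refine sum_neg_one_pow_card_le c (fun _ => True) _ h1 _ ⟨?_, fun h => ?_⟩
  · rintro rfl a ha
    rw [hc, rev_one] at ha
    obtain ⟨t, ht⟩ := ha
    exact absurd ht.symm (of_mul_ne_one a t)
  · by_contra hw
    have hw' : rev w ≠ 1 := fun h' => hw (by rw [← rev_rev w, h', rev_one])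
    obtain ⟨a, y, hy⟩ := exists_of_mul hw'
    exact h a ((hc a).2 ⟨y, hy⟩) trivial

open Classical in
/-- Graded Möbius inversion on a finite set of traces closed under divisors. -/
theorem sum_graded_moebius (D : Finset (TraceMonoid I))
    (hD : ∀ x y : TraceMonoid I, x ≤ y → y ∈ D → x ∈ D) (φ : TraceMonoid I → ℝ)
    {x : TraceMonoid I} (hx : x ∈ D) :
    ∑ y ∈ D with x ≤ y, ∑ d : Clique I with y * d.toTrace ∈ D,
      (-1 : ℝ) ^ d.1.card * φ (y * d.toTrace) = φ x := by
  have h1 : ∀ y, ∑ d : Clique I with y * d.toTrace ∈ D,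
      (-1 : ℝ) ^ d.1.card * φ (y * d.toTrace) =
      ∑ z ∈ D, ∑ d : Clique I, if y * d.toTrace = z then (-1 : ℝ) ^ d.1.card * φ z else 0 := by
    intro y
    rw [Finset.sum_comm, Finset.sum_filter]
    refine Finset.sum_congr rfl fun d _ => ?_
    rw [Finset.sum_ite_eq D (y * d.toTrace)]
  rw [Finset.sum_congr rfl fun y _ => h1 y, Finset.sum_comm]
  -- The coefficient of `φ z`: for `z = x w`, the factorisations `z = y d` with `x ≤ y` correspond
  -- to the cliques `d` dividing `w` on the right, whose alternating sum vanishes unless `w = 1`.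
  have h2 : ∀ z ∈ D, (∑ y ∈ D with x ≤ y, ∑ d : Clique I,
      if y * d.toTrace = z then (-1 : ℝ) ^ d.1.card * φ z else 0) =
      if z = x then φ z else 0 := by
    intro z hz
    rw [Finset.sum_comm]
    have h3 : ∀ d : Clique I, (∑ y ∈ D with x ≤ y,
        if y * d.toTrace = z then (-1 : ℝ) ^ d.1.card * φ z else 0) =
        if ∃ v, z = x * (v * d.toTrace) then (-1 : ℝ) ^ d.1.card * φ z else 0 := by
      intro d
      split_ifs with h
      · obtain ⟨v, rfl⟩ := h
        rw [← mul_assoc] at hz ⊢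
        rw [Finset.sum_eq_single (x * v)]
        · rw [if_pos rfl]
        · exact fun y _ hy => if_neg fun h => hy (mul_right_cancel' h)
        · exact fun h => absurd (Finset.mem_filter.2
            ⟨hD _ _ (le_mul_right' _ _) hz, le_mul_right' _ _⟩) h
      · refine Finset.sum_eq_zero fun y hy => if_neg ?_
        rintro rfl
        obtain ⟨v, rfl⟩ := (Finset.mem_filter.1 hy).2
        exact h ⟨v, mul_assoc _ _ _⟩
    rw [Finset.sum_congr rfl fun d _ => h3 d, ← Finset.sum_filter, ← Finset.sum_mul]
    by_cases hxz : x ≤ z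
    · obtain ⟨w, rfl⟩ := hxz
      have h4 : ∀ d : Clique I, (∃ v, x * w = x * (v * d.toTrace)) ↔ ∃ v, w = v * d.toTrace :=
        fun d => exists_congr fun v => ⟨mul_left_cancel', fun h => by rw [h]⟩
      simp only [h4]
      rw [sum_neg_one_pow_card_right_divisor]
      by_cases hw : w = 1
      · simp [hw]
      · rw [if_neg hw, if_neg, zero_mul]
        exact fun h => hw (mul_left_cancel' (h.trans (mul_one x).symm))
    · rw [if_neg (by rintro rfl; exact hxz le_rfl), Finset.filter_false_of_mem, Finset.sum_empty,
        zero_mul]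
      rintro d - ⟨v, rfl⟩
      exact hxz (le_mul_right' _ _)
  rw [Finset.sum_congr rfl h2, Finset.sum_ite_eq' D x, if_pos hx]

end Sums

/-! ### Möbius valuations and weights of paths -/

section Valuation

variable {A : Type*} {I : SimpleGraph A} {X : Type*}

theorem IsMoebius.normalisation_nonneg [Finite A] {f : X → TraceMonoid I → ℝ} (hfM : IsMoebius f)
    (α : X) (c : NonemptyClique I) : 0 ≤ normalisation f α c :=
  Finset.sum_nonneg fun _ _ => hfM.nonneg _ _

theorem IsMoebius.initialWeight_nonneg [Finite A] {f : X → TraceMonoid I → ℝ} (hfM : IsMoebius f)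
    (α : X) (s : X × NonemptyClique I) : 0 ≤ initialWeight f α s := by
  rw [initialWeight]
  split_ifs
  exacts [hfM.nonneg _ _, le_rfl]

-- `γ → γ'` says that no letter of `γ'` is independent of all of `γ`, which is the condition treated
-- by `sum_moebiusTransform`.
open Classical in
theorem IsMoebius.normalisation_eq [Finite A] {f : X → TraceMonoid I → ℝ} (hfM : IsMoebius f)
    (α : X) (c : NonemptyClique I) :
    normalisation f α c =
      ∑ d : Clique I with c.1.Parallel d, (-1 : ℝ) ^ d.1.card * f α d.toTrace := by
  rw [normalisation, sum_nonemptyClique (moebiusTransform (f α)) _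
    (fun d => ∀ b ∈ d.1, ¬ ∀ a ∈ c.1.1, I.Adj a b) (fun d => ?_) (hfM.empty α)]
  · exact sum_moebiusTransform (f α) (fun b => ∀ a ∈ c.1.1, I.Adj a b) _ _ (fun _ => Iff.rfl)
      fun d => ⟨fun h b hb a ha => h a ha b hb, fun h a ha b hb => h b hb a ha⟩
  · simp only [NonemptyClique.CartierFoata, not_forall, exists_prop]

variable [MulAction (TraceMonoid I)ᵐᵒᵖ X]

theorem actBy_one (α : X) : actBy α (1 : TraceMonoid I) = α := by
  rw [actBy, MulOpposite.op_one, one_smul]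

theorem actBy_mul (α : X) (x y : TraceMonoid I) : actBy α (x * y) = actBy (actBy α x) y := by
  rw [actBy, actBy, actBy, MulOpposite.op_mul, mul_smul]

variable [Finite A] {f : X → TraceMonoid I → ℝ}

-- The cliques containing `c` are the products `c d` with `d` parallel to `c`, and `f` factors along
-- them.
open Classical in
theorem IsFibredValuation.moebiusTransform_eq (hf : IsFibredValuation f) (α : X) (c : Clique I) :
    moebiusTransform (f α) c = f α c.toTrace *
      ∑ d : Clique I with c.Parallel d, (-1 : ℝ) ^ d.1.card * f (actBy α c.toTrace) d.toTrace := by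
  rw [moebiusTransform, Finset.mul_sum]
  symm
  refine Finset.sum_bij (fun d hd => c.union d (Finset.mem_filter.1 hd).2) ?_ ?_ ?_ ?_
  · intro d hd
    exact Finset.mem_filter.2 ⟨Finset.mem_univ _, fun a ha => (Clique.mem_union _).2 (Or.inl ha)⟩
  · intro d hd e he h
    have h' := congrArg Clique.toTrace h
    rw [Clique.toTrace_union, Clique.toTrace_union] at h'
    exact Clique.toTrace_injective (mul_left_cancel' h')
  · intro c' hc'
    have hc' := (Finset.mem_filter.1 hc').2
    have hpar : c.Parallel ⟨c'.1 \ c.1, c'.2.subset (by simp)⟩ := by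
      intro a ha b hb
      obtain ⟨h1, h2⟩ := Finset.mem_sdiff.1 hb
      exact c'.2 (hc' ha) h1 (by rintro rfl; exact h2 ha)
    refine ⟨_, Finset.mem_filter.2 ⟨Finset.mem_univ _, hpar⟩, ?_⟩
    ext a
    rw [Clique.mem_union]
    have : a ∈ c.1 → a ∈ c'.1 := fun h => hc' h
    simp only [Finset.mem_sdiff]
    tauto
  · intro d hd
    rw [Clique.toTrace_union, Clique.card_union, Nat.add_sub_cancel_left, hf.map_mul]
    ring

/-- Both `h` and `g` are alternating sums over the cliques parallel to `c`. This identity makes path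
weights telescope. -/
theorem IsMoebius.moebiusTransform_eq (hf : IsFibredValuation f) (hfM : IsMoebius f) (α : X)
    (c : NonemptyClique I) : moebiusTransform (f α) c.1 =
      f α c.toTrace * normalisation f (actBy α c.toTrace) c := by
  rw [hfM.normalisation_eq, hf.moebiusTransform_eq]; rfl

theorem IsMoebius.sum_moebiusTransform_eq_one (hf : IsFibredValuation f) (hfM : IsMoebius f)
    (α : X) : ∑ c : NonemptyClique I, moebiusTransform (f α) c.1 = 1 := by
  classical
  have h1 := sum_nonemptyClique (moebiusTransform (f α)) (fun _ => True) (fun _ => True)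
    (fun _ => Iff.rfl) (hfM.empty α)
  have h2 := sum_moebiusTransform (f α) (fun _ => False) (fun _ => True) (· = Clique.empty I)
    (by simp) fun d => ⟨by rintro rfl; simp [Clique.empty],
      fun h => Subtype.ext (Finset.eq_empty_of_forall_notMem h)⟩
  rw [Finset.filter_true] at h1
  rw [h1, h2, Finset.filter_eq', if_pos (Finset.mem_univ _), Finset.sum_singleton,
    Clique.toTrace_empty, hf.map_one]
  simp [Clique.empty]

theorem IsMoebius.transitionMatrix_nonneg (hfM : IsMoebius f) (s t : X × NonemptyClique I) :
    0 ≤ transitionMatrix f s t := by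
  rw [transitionMatrix]
  split_ifs
  exacts [div_nonneg (hfM.nonneg _ _) (hfM.normalisation_nonneg _ _), le_rfl]

/-- The states-and-cliques `(α · c₀ ⋯ cᵢ₋₁, cᵢ)` read along a sequence of cliques. -/
def statePath (α : X) (c : ℕ → NonemptyClique I) (i : ℕ) : X × NonemptyClique I :=
  (actBy α (partialProd c i), c i)

/-- At each step the factor `g` in `h(cₙ) = f(cₙ) g(cₙ)` cancels the denominator of the next
transition, leaving `f(cₙ)` and the new `h`. -/
theorem IsMoebius.weight_statePath (hf : IsFibredValuation f) (hfM : IsMoebius f) (α : X)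
    {c : ℕ → NonemptyClique I} {n : ℕ} (hc : IsNormal c n) :
    initialWeight f α (statePath α c 0) *
      ∏ i ∈ Finset.range n, transitionMatrix f (statePath α c i) (statePath α c (i + 1)) =
      f α (partialProd c n) * moebiusTransform (f (actBy α (partialProd c n))) (c n).1 := by
  induction n with
  | zero => simp [initialWeight, statePath, partialProd, actBy_one, hf.map_one]
  | succ n ih =>
    rw [Finset.prod_range_succ, ← mul_assoc, ih fun i hi => hc i (by omega),
      hfM.moebiusTransform_eq hf]
    have hact : actBy α (partialProd c (n + 1)) =
        actBy (actBy α (partialProd c n)) (c n).toTrace := actBy_mul _ _ _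
    rw [partialProd_succ, hf.map_mul, ← partialProd_succ, hact]
    set β := actBy α (partialProd c n) with hβ
    -- If `g = 0`, all its non-negative terms vanish, among them the next `h`, so the convention `0`
    -- for the transition is harmless.
    by_cases hg : normalisation f (actBy β (c n).toTrace) (c n) = 0
    · have h0 : moebiusTransform (f (actBy β (c n).toTrace)) (c (n + 1)).1 = 0 := by
        classical
        rw [normalisation, Finset.sum_eq_zero_iff_of_nonneg fun _ _ => hfM.nonneg _ _] at hg
        exact hg _ (Finset.mem_filter.2 ⟨Finset.mem_univ _, hc n (by omega)⟩)
      rw [hg, h0]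
      simp
    · have hP : transitionMatrix f (statePath α c n) (statePath α c (n + 1)) =
          moebiusTransform (f (actBy β (c n).toTrace)) (c (n + 1)).1 /
            normalisation f (actBy β (c n).toTrace) (c n) := by
        rw [← hact]
        exact if_pos ⟨hact, hc n (by omega), by rw [← hact] at hg; exact hg⟩
      rw [hP]
      field_simp

open Classical in
theorem IsMoebius.weight_statePath_eq_sum (hf : IsFibredValuation f) (hfM : IsMoebius f) (α : X)
    {c : ℕ → NonemptyClique I} {n : ℕ} (hc : IsNormal c n) :
    initialWeight f α (statePath α c 0) *
      ∏ i ∈ Finset.range n, transitionMatrix f (statePath α c i) (statePath α c (i + 1)) =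
      ∑ d : Clique I with partialProd c (n + 1) * d.toTrace ∈ cliqueProducts I (n + 1),
        (-1 : ℝ) ^ d.1.card * f α (partialProd c (n + 1) * d.toTrace) := by
  rw [hfM.weight_statePath hf α hc, hf.moebiusTransform_eq, Finset.mul_sum, Finset.mul_sum]
  simp only [hc.mul_mem_iff]
  refine Finset.sum_congr rfl fun d _ => ?_
  rw [partialProd_succ, mul_assoc, hf.map_mul, hf.map_mul, NonemptyClique.toTrace]
  ring

-- At height at most `n` the truncation excludes no clique, and the sum is `f_α(y) h_{α·y}(1)`.
open Classical in
theorem IsMoebius.sum_mul_clique_eq_zero (hf : IsFibredValuation f) (hfM : IsMoebius f) (α : X)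
    {n : ℕ} {y : TraceMonoid I} (hy : y ∈ cliqueProducts I n) :
    ∑ d : Clique I with y * d.toTrace ∈ cliqueProducts I (n + 1),
        (-1 : ℝ) ^ d.1.card * f α (y * d.toTrace) = 0 := by
  rw [Finset.filter_true_of_mem fun d _ => by
    rw [cliqueProducts_succ]; exact ⟨y, hy, _, ⟨d, rfl⟩, rfl⟩]
  have h := hfM.empty (actBy α y)
  rw [hf.moebiusTransform_eq, Clique.toTrace_empty, hf.map_one, one_mul, actBy_one] at h
  rw [Finset.filter_true_of_mem fun d _ => by simp [Clique.Parallel, Clique.empty]] at h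
  rw [← mul_zero (f α y), ← h, Finset.mul_sum]
  refine Finset.sum_congr rfl fun d _ => ?_
  rw [hf.map_mul]
  ring

end Valuation

/-! ### Cylinders and the Borel σ-algebra of the boundary -/

namespace Boundary

variable {A : Type*} {I : SimpleGraph A}

theorem mem_cylinder {x : TraceMonoid I} {ξ : Boundary I} :
    ξ ∈ cylinder x ↔ GenTrace.ofTrace x ≤ ξ.1 := Iff.rfl

theorem ofTrace_le_iff {x : TraceMonoid I} {ξ : GenTrace I} :
    GenTrace.ofTrace x ≤ ξ ↔ x ∈ (show Order.Ideal (TraceMonoid I) from ξ) :=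
  Order.Ideal.principal_le_iff

theorem infiniteTrace_mem_cylinder {c : ℕ → NonemptyClique I} {x : TraceMonoid I} :
    infiniteTrace c ∈ cylinder x ↔ ∃ n, x ≤ partialProd c n := by
  rw [mem_cylinder, ofTrace_le_iff]; rfl

/-- Ideals are directed, so two traces below a common boundary point have a common upper bound,
hence a supremum, which is the base of the intersection. -/
theorem isPiSystem_cylinder : IsPiSystem (Set.range (cylinder (I := I))) := by
  rintro _ ⟨x, rfl⟩ _ ⟨y, rfl⟩ ⟨ξ, hx, hy⟩
  rw [mem_cylinder, ofTrace_le_iff] at hx hy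
  obtain ⟨z, -, hxz, hyz⟩ := Order.Ideal.directed _ x hx y hy
  obtain ⟨w, hw⟩ := exists_isLUB hxz hyz
  refine ⟨w, Set.ext fun ζ => ?_⟩
  rw [Set.mem_inter_iff, mem_cylinder, mem_cylinder, mem_cylinder, ofTrace_le_iff, ofTrace_le_iff,
    ofTrace_le_iff]
  constructor
  · exact fun h => ⟨Order.Ideal.lower _ (hw.1 (by simp)) h, Order.Ideal.lower _ (hw.1 (by simp)) h⟩
  · rintro ⟨h1, h2⟩
    obtain ⟨t, ht, h3, h4⟩ := Order.Ideal.directed _ x h1 y h2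
    refine Order.Ideal.lower _ (hw.2 ?_) ht
    rintro _ (rfl | rfl)
    exacts [h3, h4]

/-- The countable subbasis formed by the cylinders and their complements. -/
theorem topology_eq_generateFrom : (inferInstance : TopologicalSpace (Boundary I)) =
    TopologicalSpace.generateFrom (Set.range (cylinder (I := I)) ∪
      Set.range fun x : TraceMonoid I => (cylinder x)ᶜ) := by
  have h0 : (inferInstance : TopologicalSpace (Boundary I)) = TopologicalSpace.generateFrom
      ((fun s : Set (GenTrace I) => (Subtype.val ⁻¹' s : Set (Boundary I))) ''
        (Set.range (fun x : TraceMonoid I => Set.Ici (GenTrace.ofTrace x)) ∪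
          Set.range (fun ξ : GenTrace I => (Set.Ici ξ)ᶜ))) :=
    induced_generateFrom_eq
  rw [h0]
  apply le_antisymm
  · refine le_generateFrom ?_
    rintro _ (⟨x, rfl⟩ | ⟨x, rfl⟩)
    · exact TopologicalSpace.isOpen_generateFrom_of_mem ⟨_, Or.inl ⟨x, rfl⟩, rfl⟩
    · exact TopologicalSpace.isOpen_generateFrom_of_mem ⟨_, Or.inr ⟨_, rfl⟩, rfl⟩
  · refine le_generateFrom ?_
    rintro _ ⟨_, ⟨x, rfl⟩ | ⟨ξ, rfl⟩, rfl⟩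
    · exact TopologicalSpace.isOpen_generateFrom_of_mem (Or.inl ⟨x, rfl⟩)
    -- The order is inclusion of ideals: `ξ ≤ ζ` fails exactly when some trace of `ξ` is missing
    -- from `ζ`.
    · have : (Subtype.val ⁻¹' (Set.Ici ξ)ᶜ : Set (Boundary I)) =
          ⋃ x ∈ (show Order.Ideal (TraceMonoid I) from ξ), (cylinder x)ᶜ := by
        ext ζ
        simp only [Set.mem_compl_iff, Set.mem_iUnion, mem_cylinder,
          ofTrace_le_iff, exists_prop]
        exact Set.not_subset
      let τ := TopologicalSpace.generateFrom (Set.range (cylinder (I := I)) ∪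
        Set.range fun x : TraceMonoid I => (cylinder x)ᶜ)
      have h1 : IsOpen[τ] (⋃ x ∈ (show Order.Ideal (TraceMonoid I) from ξ), (cylinder x)ᶜ) :=
        isOpen_biUnion fun x _ =>
          TopologicalSpace.isOpen_generateFrom_of_mem (Or.inr ⟨x, rfl⟩)
      rw [← this] at h1
      exact h1

/-- The Borel `σ`-algebra of the boundary is generated by the cylinders. -/
theorem measurableSpace_eq_generateFrom [Countable A] :
    (inferInstance : MeasurableSpace (Boundary I)) =
      MeasurableSpace.generateFrom (Set.range (cylinder (I := I))) := by
  -- Countability of the monoid makes the subbasis countable, so it generates the Borel σ-algebra.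
  have h2 : SecondCountableTopology (Boundary I) :=
    ⟨_, (Set.countable_range _).union (Set.countable_range _), topology_eq_generateFrom⟩
  have h1 : (inferInstance : MeasurableSpace (Boundary I)) = _ :=
    borel_eq_generateFrom_of_subbasis topology_eq_generateFrom
  rw [h1]
  apply le_antisymm
  · refine MeasurableSpace.generateFrom_le ?_
    rintro _ (⟨x, rfl⟩ | ⟨x, rfl⟩)
    · exact MeasurableSpace.measurableSet_generateFrom ⟨x, rfl⟩
    · exact (MeasurableSpace.measurableSet_generateFrom (Set.mem_range_self x)).compl
  · exact MeasurableSpace.generateFrom_mono Set.subset_union_left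

theorem measurableSet_cylinder [Countable A] (x : TraceMonoid I) : MeasurableSet (cylinder x) := by
  have h : MeasurableSet[MeasurableSpace.generateFrom (Set.range (cylinder (I := I)))]
    (cylinder x) := MeasurableSpace.measurableSet_generateFrom ⟨x, rfl⟩
  rw [← measurableSpace_eq_generateFrom] at h
  exact h

/-- A probability measure on the boundary is determined by the cylinders. -/
theorem measure_ext [Countable A] {μ ν : Measure (Boundary I)} [IsProbabilityMeasure μ]
    [IsProbabilityMeasure ν] (h : ∀ x, μ.real (cylinder x) = ν.real (cylinder x)) : μ = ν := by
  refine ext_of_generate_finite _ measurableSpace_eq_generateFrom isPiSystem_cylinder ?_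
    (by rw [measure_univ, measure_univ])
  rintro _ ⟨x, rfl⟩
  exact (measureReal_eq_measureReal_iff).1 (h x)

end Boundary

/-! ### Measurability of the infinite trace -/

section Measurability

variable {A : Type*} {I : SimpleGraph A} {Ω : Type*} [MeasurableSpace Ω]

theorem measurableSet_partialProd_eq [Finite A] {C : ℕ → Ω → NonemptyClique I}
    (hC : ∀ i, Measurable (C i)) (n : ℕ) (s : Set (TraceMonoid I)) :
    MeasurableSet {ω | partialProd (fun i => C i ω) n ∈ s} := by
  let _ : MeasurableSpace (TraceMonoid I) := ⊤
  have : Measurable fun ω => partialProd (fun i => C i ω) n := by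
    induction n with
    | zero => exact measurable_const
    | succ n ih =>
      have h1 : Measurable fun p : TraceMonoid I × NonemptyClique I => p.1 * p.2.toTrace :=
        measurable_from_prod_countable_right fun _ => measurable_from_top
      exact h1.comp (ih.prodMk (hC n))
  exact this trivial

theorem measurable_infiniteTrace [Finite A] {C : ℕ → Ω → NonemptyClique I}
    (hC : ∀ i, Measurable (C i)) : Measurable fun ω => infiniteTrace fun i => C i ω := by
  have h := Boundary.measurableSpace_eq_generateFrom (I := I)
  rw [show (Boundary.instMeasurableSpace : MeasurableSpace (Boundary I)) = _ from h]
  refine measurable_generateFrom ?_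
  rintro _ ⟨x, rfl⟩
  have : (fun ω => infiniteTrace fun i => C i ω) ⁻¹' Boundary.cylinder x =
      ⋃ n, {ω | partialProd (fun i => C i ω) n ∈ Set.Ici x} := by
    ext ω
    simp [Boundary.infiniteTrace_mem_cylinder]
  rw [this]
  exact MeasurableSet.iUnion fun n => measurableSet_partialProd_eq hC n _

end Measurability

/-! ### Markov chains on countable sets -/

section MarkovChain

open ProbabilityTheory

variable {E : Type*} [Countable E] [MeasurableSpace E]

/-- Almost surely, all prefixes of the path of a Markov chain have non zero weight. -/
theorem IsMarkovChain.ae_weight_ne_zero {Ω : Type*} [MeasurableSpace Ω] {ν : E → ℝ} {P : E → E → ℝ}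
    {Q : Measure Ω} {Z : ℕ → Ω → E} (h : IsMarkovChain ν P Q Z) :
    ∀ᵐ ω ∂Q, ∀ n, ν (Z 0 ω) * ∏ i ∈ Finset.range n, P (Z i ω) (Z (i + 1) ω) ≠ 0 := by
  have := h.isProbabilityMeasure
  rw [ae_all_iff]
  intro n
  -- Extends a history by its last value. Histories are countably many, so those of zero weight can
  -- be discarded together.
  let e : (Finset.Iic n → E) → ℕ → E := fun v i => v ⟨min i n, by simp⟩
  have hnull : ∀ v : Finset.Iic n → E,
      ν (e v 0) * ∏ i ∈ Finset.range n, P (e v i) (e v (i + 1)) = 0 →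
      ∀ᵐ ω ∂Q, ¬ ∀ i ≤ n, Z i ω = e v i := by
    intro v hv
    have h1 := h.law n (e v)
    rw [hv, measureReal_eq_zero_iff] at h1
    rw [ae_iff]
    simpa using h1
  have hall : ∀ᵐ ω ∂Q, ∀ v : Finset.Iic n → E,
      ν (e v 0) * ∏ i ∈ Finset.range n, P (e v i) (e v (i + 1)) = 0 →
      ¬ ∀ i ≤ n, Z i ω = e v i := by
    rw [ae_all_iff]
    intro v
    by_cases hv : ν (e v 0) * ∏ i ∈ Finset.range n, P (e v i) (e v (i + 1)) = 0
    · filter_upwards [hnull v hv] with ω hω _ using hω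
    · exact Filter.Eventually.of_forall fun ω h0 => absurd h0 hv
  filter_upwards [hall] with ω hω h0
  have hZ : ∀ i ≤ n, Z i ω = e (fun j => Z j ω) i := fun i hi => by simp [e, hi]
  refine hω (fun j => Z j ω) ?_ hZ
  rw [← h0, ← hZ 0 (Nat.zero_le n)]
  congr 1
  refine Finset.prod_congr rfl fun i hi => ?_
  have := Finset.mem_range.1 hi
  rw [← hZ i (by omega), ← hZ (i + 1) (by omega)]

variable [DiscreteMeasurableSpace E]

/-- The kernel giving the next step of a homogeneous chain from its history. -/
def historyKernel (κ : Kernel E E) (n : ℕ) : Kernel (Finset.Iic n → E) E :=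
  κ.comap (fun x => x ⟨n, Finset.mem_Iic.2 le_rfl⟩) (measurable_pi_apply _)

instance (κ : Kernel E E) [IsMarkovKernel κ] (n : ℕ) : IsMarkovKernel (historyKernel κ n) :=
  inferInstanceAs (IsMarkovKernel (κ.comap _ _))

/-- Existence of homogeneous Markov chains on a countable set. -/
theorem exists_measure_markovChain (ν : Measure E) [IsProbabilityMeasure ν] (κ : Kernel E E)
    [IsMarkovKernel κ] : ∃ Q : Measure (ℕ → E), IsProbabilityMeasure Q ∧
      ∀ (n : ℕ) (z : ℕ → E), Q {ω | ∀ i ≤ n, ω i = z i} =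
        ν {z 0} * ∏ i ∈ Finset.range n, κ (z i) {z (i + 1)} := by
  let K : (n : ℕ) → Kernel (Finset.Iic n → E) E := historyKernel κ
  let ν₀ : Measure (Finset.Iic 0 → E) := ν.map (fun e _ => e)
  have hm : Measurable (fun (e : E) (_ : Finset.Iic 0) => e) := by fun_prop
  have : IsProbabilityMeasure ν₀ := Measure.isProbabilityMeasure_map hm.aemeasurable
  let μ : (n : ℕ) → Measure (Finset.Iic n → E) := fun n =>
    Kernel.partialTraj (X := fun _ => E) K 0 n ∘ₘ ν₀
  let r : (z : ℕ → E) → (n : ℕ) → (Finset.Iic n → E) := fun z n i => z i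
  have hμ : ∀ (z : ℕ → E) (n : ℕ), μ n {r z n} =
      ν {z 0} * ∏ i ∈ Finset.range n, κ (z i) {z (i + 1)} := by
    intro z n
    induction n with
    | zero =>
      simp only [μ, Finset.range_zero, Finset.prod_empty, mul_one]
      rw [Kernel.partialTraj_self, Measure.id_comp, Measure.map_apply hm (measurableSet_singleton _)]
      congr 1
      ext e
      simp only [Set.mem_preimage, Set.mem_singleton_iff]
      constructor
      · exact fun h => congrFun h ⟨0, by simp⟩
      · rintro rfl
        funext ⟨i, hi⟩
        have : i = 0 := by simpa using hi
        subst this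
        rfl
    | succ n ih =>
      have h1 : μ (n + 1) = (μ n ⊗ₘ ((K n).map (MeasurableEquiv.piSingleton (X := fun _ => E) n))).map
          (IicProdIoc (X := fun _ => E) n (n + 1)) := by
        simp only [μ]
        rw [Kernel.partialTraj_succ_of_le (Nat.zero_le n), Measure.compProd_eq_comp_prod,
          Measure.comp_assoc, Measure.map_comp _ _ (by fun_prop)]
      have h2 : (IicProdIoc (X := fun _ => E) n (n + 1)) ⁻¹' {r z (n + 1)} =
          {r z n} ×ˢ {fun i : Finset.Ioc n (n + 1) => z i} := by
        ext ⟨x, y⟩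
        simp only [Set.mem_preimage, Set.mem_singleton_iff, Set.mem_prod, funext_iff, IicProdIoc,
          Subtype.forall, r]
        constructor
        · refine fun h => ⟨fun i hi => ?_, fun i hi => ?_⟩
          · have := h i (Finset.mem_Iic.2 ((Finset.mem_Iic.1 hi).trans (Nat.le_succ n)))
            rwa [dif_pos (Finset.mem_Iic.1 hi)] at this
          · have := h i (Finset.mem_Iic.2 (Finset.mem_Ioc.1 hi).2)
            rwa [dif_neg (not_le.2 (Finset.mem_Ioc.1 hi).1)] at this
        · rintro ⟨h1, h2⟩ i hi
          split_ifs with h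
          exacts [h1 i _, h2 i _]
      rw [h1, Measure.map_apply (by fun_prop) (measurableSet_singleton _), h2,
        Measure.compProd_apply_prod (measurableSet_singleton _) (measurableSet_singleton _),
        lintegral_singleton, ih, Finset.prod_range_succ,
        Kernel.map_apply' _ (by fun_prop) _ (measurableSet_singleton _), mul_comm, mul_assoc]
      congr 3
      ext e
      simp only [Set.mem_preimage, Set.mem_singleton_iff]
      constructor
      · intro h
        have := congrArg (MeasurableEquiv.piSingleton (X := fun _ => E) n).symm h
        rwa [MeasurableEquiv.symm_apply_apply] at this
      · rintro rfl
        funext ⟨i, hi⟩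
        have : i = n + 1 := by rw [Finset.mem_Ioc] at hi; omega
        subst this
        rfl
  refine ⟨Kernel.traj (X := fun _ => E) K 0 ∘ₘ ν₀, inferInstance, fun n z => ?_⟩
  rw [← hμ]
  simp only [μ]
  rw [← Kernel.traj_map_frestrictLe, ← Measure.map_comp _ _ (by fun_prop),
    Measure.map_apply (by fun_prop) (measurableSet_singleton _)]
  congr 1
  ext ω
  simp [r, funext_iff, Preorder.frestrictLe]

/-- The law of a Markov chain on the canonical space is determined by its initial distribution and
its transition matrix. -/
theorem IsMarkovChain.unique {ν : E → ℝ} {P : E → E → ℝ} {Q Q' : Measure (ℕ → E)}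
    (h : IsMarkovChain ν P Q fun i ω => ω i) (h' : IsMarkovChain ν P Q' fun i ω => ω i) :
    Q = Q' := by
  have := h.isProbabilityMeasure
  have := h'.isProbabilityMeasure
  have hP : IsProjectiveMeasureFamily (α := fun _ : ℕ => E) (fun J : Finset ℕ => Q.map (J.restrict (π := fun _ => E))) := by
    intro I J hJI
    rw [Measure.map_map (by fun_prop) (by fun_prop)]
    rfl
  have hQ : IsProjectiveLimit (α := fun _ : ℕ => E) Q (fun J : Finset ℕ => Q.map (J.restrict (π := fun _ => E))) :=
    fun _ => rfl
  have hQ' : IsProjectiveLimit (α := fun _ : ℕ => E) Q' (fun J : Finset ℕ => Q.map (J.restrict (π := fun _ => E))) := by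
    -- It suffices to compare marginals on initial segments, which live on countable sets and are
    -- determined by singletons.
    rw [isProjectiveLimit_nat_iff hP]
    intro n
    refine Measure.ext_of_singleton fun v => ?_
    rw [Measure.map_apply (by fun_prop) (measurableSet_singleton _),
      Measure.map_apply (by fun_prop) (measurableSet_singleton _)]
    have hv : (Finset.restrict (Finset.Iic n) ⁻¹' {v} : Set (ℕ → E)) =
        {ω | ∀ i ≤ n, ω i = v ⟨min i n, by simp⟩} := by
      ext ω
      simp only [Set.mem_preimage, Set.mem_singleton_iff, funext_iff, Subtype.forall,
        Finset.mem_Iic, Finset.restrict, Set.mem_ofPred_eq]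
      refine forall₂_congr fun i hi => ?_
      simp [hi]
    change Q' (Finset.restrict (Finset.Iic n) ⁻¹' {v}) = _
    rw [hv, ← measureReal_eq_measureReal_iff]
    exact (h'.law n fun i => v ⟨min i n, by simp⟩).trans
      (h.law n fun i => v ⟨min i n, by simp⟩).symm
  have : ∀ J : Finset ℕ, IsFiniteMeasure (Q.map (J.restrict (π := fun _ => E))) :=
    fun J => inferInstance
  exact hQ.unique hQ'

end MarkovChain

/-! ### The chain of states-and-cliques -/

section StatesAndCliques

open ProbabilityTheory

variable {A : Type*} [Finite A] {I : SimpleGraph A} {X : Type*} [MulAction (TraceMonoid I)ᵐᵒᵖ X]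
  {f : X → TraceMonoid I → ℝ}

/-- No factor of the weight vanishes, so every transition is admissible. Hence the chain almost
surely runs through normal forms, with states dictated by the cliques. -/
theorem eq_statePath_of_weight_ne_zero {α : X} {z : ℕ → X × NonemptyClique I} {n : ℕ}
    (h : initialWeight f α (z 0) *
      ∏ i ∈ Finset.range n, transitionMatrix f (z i) (z (i + 1)) ≠ 0) :
    IsNormal (fun i => (z i).2) n ∧ ∀ i ≤ n, z i = statePath α (fun i => (z i).2) i := by
  have h0 : (z 0).1 = α := by
    by_contra h0
    exact h (by rw [initialWeight, if_neg h0, zero_mul])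
  have hstep : ∀ i < n, (z (i + 1)).1 = actBy (z i).1 (z i).2.toTrace ∧
      (z i).2.CartierFoata (z (i + 1)).2 := by
    intro i hi
    by_contra hcon
    refine h (mul_eq_zero_of_right _ (Finset.prod_eq_zero (Finset.mem_range.2 hi) ?_))
    exact if_neg fun h' => hcon ⟨h'.1, h'.2.1⟩
  refine ⟨fun i hi => (hstep i hi).2, fun i => ?_⟩
  induction i with
  | zero => exact fun _ => Prod.ext (by rw [h0, statePath, partialProd, actBy_one]) rfl
  | succ i ih =>
    intro hi
    refine Prod.ext ?_ rfl
    rw [(hstep i (by omega)).1, statePath, partialProd_succ, actBy_mul]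
    exact congrArg (fun s : X × NonemptyClique I => actBy s.1 (z i).2.toTrace) (ih (by omega))

theorem IsMoebius.sum_initialWeight [Fintype X] (hf : IsFibredValuation f) (hfM : IsMoebius f)
    (α : X) : ∑ s : X × NonemptyClique I, initialWeight f α s = 1 := by
  classical
  rw [Fintype.sum_prod_type, Finset.sum_eq_single α]
  · simpa [initialWeight] using hfM.sum_moebiusTransform_eq_one hf α
  · intro β _ hβ
    simp [initialWeight, hβ]
  · simp

theorem sum_transitionMatrix [Fintype X] (s : X × NonemptyClique I)
    (hg : normalisation f (actBy s.1 s.2.toTrace) s.2 ≠ 0) :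
    ∑ t : X × NonemptyClique I, transitionMatrix f s t = 1 := by
  classical
  rw [Fintype.sum_prod_type, Finset.sum_eq_single (actBy s.1 s.2.toTrace)]
  · simp only [transitionMatrix, true_and, hg, ne_eq, not_false_eq_true, and_true]
    rw [← Finset.sum_filter, ← Finset.sum_div, div_eq_one_iff_eq hg, normalisation]
  · intro β _ hβ
    simp [transitionMatrix, hβ]
  · simp

variable [MeasurableSpace X] {Ω : Type*} [MeasurableSpace Ω] {Q : Measure Ω}
  {Z : ℕ → Ω → X × NonemptyClique I} {α : X}

theorem IsMarkovChain.measurable_clique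
    (h : IsMarkovChain (initialWeight f α) (transitionMatrix f) Q Z) (i : ℕ) :
    Measurable fun ω => (Z i ω).2 :=
  measurable_snd.comp (h.measurable i)

variable [Finite X]

open Classical in
/-- The law of the product of the first `n + 1` cliques of the chain. -/
theorem IsMarkovChain.measureReal_partialProd_eq (hf : IsFibredValuation f) (hfM : IsMoebius f)
    (h : IsMarkovChain (initialWeight f α) (transitionMatrix f) Q Z) {n : ℕ} {y : TraceMonoid I}
    (hy : y ∈ cliqueProducts I (n + 1)) :
    Q.real {ω | partialProd (fun i => (Z i ω).2) (n + 1) = y} =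
      ∑ d : Clique I with y * d.toTrace ∈ cliqueProducts I (n + 1),
        (-1 : ℝ) ^ d.1.card * f α (y * d.toTrace) := by
  have := h.isProbabilityMeasure
  have hae : ∀ᵐ ω ∂Q, ∀ n, IsNormal (fun i => (Z i ω).2) n ∧
      ∀ i ≤ n, Z i ω = statePath α (fun i => (Z i ω).2) i := by
    filter_upwards [h.ae_weight_ne_zero] with ω hω n
    exact eq_statePath_of_weight_ne_zero (z := fun i => Z i ω) (hω n)
  -- When `y` has height at most `n` both sides vanish; otherwise uniqueness of the normal form
  -- makes the event almost surely a single path.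
  by_cases hy' : y ∈ cliqueProducts I n
  · rw [hfM.sum_mul_clique_eq_zero hf α hy', measureReal_eq_zero_iff]
    refine measure_eq_zero_iff_ae_notMem.2 ?_
    filter_upwards [hae] with ω hω hωy
    have := (hω n).1.mul_notMem 1
    rw [one_mul] at this
    exact this (hωy ▸ hy')
  · obtain ⟨c, hc, rfl⟩ := exists_isNormal_of_mem hy hy'
    rw [← hfM.weight_statePath_eq_sum hf α hc, ← h.law n (statePath α c)]
    refine measureReal_congr ?_
    filter_upwards [hae] with ω hω
    obtain ⟨h1, h2⟩ := hω n
    refine propext ⟨fun hωc i hi => ?_, fun hωc => ?_⟩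
    · have hu := h1.unique hc hωc
      rw [h2 i hi]
      refine Prod.ext ?_ (hu i hi)
      simp only [statePath]
      rw [partialProd_congr fun j hj => hu j (by omega)]
    · exact partialProd_congr fun j hj => congrArg Prod.snd (hωc j (by omega))

/-- Sum the law of the product over the multiples of `x` of height at most `n + 1`; graded Möbius
inversion collapses the sum. -/
theorem IsMarkovChain.measureReal_le_partialProd (hf : IsFibredValuation f) (hfM : IsMoebius f)
    (h : IsMarkovChain (initialWeight f α) (transitionMatrix f) Q Z) {n : ℕ} {x : TraceMonoid I}
    (hx : x ∈ cliqueProducts I (n + 1)) :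
    Q.real {ω | x ≤ partialProd (fun i => (Z i ω).2) (n + 1)} = f α x := by
  classical
  have := h.isProbabilityMeasure
  let D := (finite_cliqueProducts (I := I) (n + 1)).toFinset
  have hD : ∀ y, y ∈ D ↔ y ∈ cliqueProducts I (n + 1) := fun y => Set.Finite.mem_toFinset _
  have h1 : {ω | x ≤ partialProd (fun i => (Z i ω).2) (n + 1)} =
      ⋃ y ∈ D.filter (x ≤ ·), {ω | partialProd (fun i => (Z i ω).2) (n + 1) = y} := by
    ext ω
    simp [hD, partialProd_mem_cliqueProducts]
  rw [h1, measureReal_biUnion_finset]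
  · rw [← sum_graded_moebius D (fun a b hab hb =>
      (hD a).2 (mem_cliqueProducts_of_le hab ((hD b).1 hb))) (f α) ((hD x).2 hx)]
    refine Finset.sum_congr rfl fun y hy => ?_
    rw [h.measureReal_partialProd_eq hf hfM ((hD y).1 (Finset.mem_filter.1 hy).1)]
    simp only [hD]
  · intro y _ z _ hyz
    exact Set.disjoint_left.2 fun ω h1 h2 => hyz (h1.symm.trans h2)
  · exact fun y _ => measurableSet_partialProd_eq h.measurable_clique (n + 1) {y}

/-- The infinite trace generated by the chain of states-and-cliques gives mass `f_α(x)` to the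
cylinder of base `x`. -/
theorem IsMarkovChain.map_infiniteTrace_real_cylinder (hf : IsFibredValuation f)
    (hfM : IsMoebius f) (h : IsMarkovChain (initialWeight f α) (transitionMatrix f) Q Z)
    (x : TraceMonoid I) :
    (Q.map fun ω => infiniteTrace fun i => (Z i ω).2).real (Boundary.cylinder x) = f α x := by
  have := h.isProbabilityMeasure
  rw [map_measureReal_apply (measurable_infiniteTrace h.measurable_clique)
    (Boundary.measurableSet_cylinder x)]
  have h1 : (fun ω => infiniteTrace fun i => (Z i ω).2) ⁻¹' Boundary.cylinder x =
      ⋃ n, {ω | x ≤ partialProd (fun i => (Z i ω).2) n} := by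
    ext ω
    simp [Boundary.infiniteTrace_mem_cylinder]
  have hmono : Monotone fun n => {ω | x ≤ partialProd (fun i => (Z i ω).2) n} :=
    fun m n hmn ω hω => le_trans hω (partialProd_mono _ hmn)
  have hlim := (ENNReal.tendsto_toReal (measure_ne_top Q _)).comp
    (tendsto_measure_iUnion_atTop (μ := Q) hmono)
  rw [h1]
  refine tendsto_nhds_unique hlim (tendsto_const_nhds.congr' ?_)
  -- From here on `x` has height at most `n` and the probabilities are constant; the `+ 1` ensures
  -- `n ≥ 1`.
  filter_upwards [Filter.eventually_ge_atTop (x.length + 1)] with n hn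
  obtain ⟨m, rfl⟩ := Nat.exists_eq_add_of_le' (Nat.one_le_of_lt hn)
  exact (h.measureReal_le_partialProd hf hfM
    (cliqueProducts_mono (by omega) (mem_cliqueProducts_length x))).symm

variable [DiscreteMeasurableSpace X]

/-- Existence of the chain of states-and-cliques on the canonical space. -/
theorem IsMoebius.exists_isMarkovChain (hf : IsFibredValuation f) (hfM : IsMoebius f) (α : X) :
    ∃ Q : Measure (ℕ → X × NonemptyClique I),
      IsMarkovChain (initialWeight f α) (transitionMatrix f) Q fun i ω => ω i := by
  classical
  have := Fintype.ofFinite X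
  have hsum : ∀ φ : X × NonemptyClique I → ℝ, (∀ t, 0 ≤ φ t) → ∑ t, φ t = 1 →
      ∑ t, ENNReal.ofReal (φ t) = 1 := fun φ h0 h1 => by
    rw [← ENNReal.ofReal_sum_of_nonneg fun t _ => h0 t, h1, ENNReal.ofReal_one]
  let ν : PMF (X × NonemptyClique I) := PMF.ofFintype _
    (hsum _ (hfM.initialWeight_nonneg α) (hfM.sum_initialWeight hf α))
  -- Rows with `g = 0` are zero, hence not stochastic; they are replaced by a Dirac mass, an
  -- arbitrary choice.
  let κ : X × NonemptyClique I → PMF (X × NonemptyClique I) := fun s =>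
    if hg : normalisation f (actBy s.1 s.2.toTrace) s.2 ≠ 0 then PMF.ofFintype _
      (hsum _ (hfM.transitionMatrix_nonneg s) (sum_transitionMatrix s hg)) else PMF.pure s
  let K : Kernel (X × NonemptyClique I) (X × NonemptyClique I) :=
    ⟨fun s => (κ s).toMeasure, Measurable.of_discrete⟩
  have : IsMarkovKernel K := ⟨fun s => inferInstanceAs (IsProbabilityMeasure (κ s).toMeasure)⟩
  obtain ⟨Q, hQ, hlaw⟩ := exists_measure_markovChain ν.toMeasure K
  refine ⟨Q, hQ, fun i => measurable_pi_apply i, fun n z => ?_⟩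
  have hν : (ν.toMeasure {z 0}).toReal = initialWeight f α (z 0) := by
    rw [PMF.toMeasure_apply_singleton _ _ (measurableSet_singleton _), PMF.ofFintype_apply,
      ENNReal.toReal_ofReal (hfM.initialWeight_nonneg α _)]
  have hK : ∀ s t, normalisation f (actBy s.1 s.2.toTrace) s.2 ≠ 0 →
      (K s {t}).toReal = transitionMatrix f s t := fun s t hg => by
    change ((κ s).toMeasure {t}).toReal = _
    rw [PMF.toMeasure_apply_singleton _ _ (measurableSet_singleton _)]
    simp only [κ]
    rw [dif_pos hg, PMF.ofFintype_apply, ENNReal.toReal_ofReal (hfM.transitionMatrix_nonneg s t)]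
  rw [measureReal_def, hlaw, ENNReal.toReal_mul, ENNReal.toReal_prod, hν]
  induction n with
  | zero => simp
  | succ n ih =>
    rw [Finset.prod_range_succ, Finset.prod_range_succ, ← mul_assoc, ← mul_assoc, ih]
    -- The replaced rows do not matter: if `g = 0` then `h = f g = 0` at `z n`, so any path ending
    -- there already has zero weight.
    by_cases hg : normalisation f (actBy (z n).1 (z n).2.toTrace) (z n).2 = 0
    · suffices h0 : initialWeight f α (z 0) *
          ∏ i ∈ Finset.range n, transitionMatrix f (z i) (z (i + 1)) = 0 by
        rw [h0, zero_mul, zero_mul]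
      by_contra hne
      obtain ⟨h1, h2⟩ := eq_statePath_of_weight_ne_zero hne
      refine hne ?_
      have h3 := hfM.weight_statePath hf α h1
      rw [← h2 0 (Nat.zero_le n), Finset.prod_congr rfl fun i hi => by
        have := Finset.mem_range.1 hi
        rw [← h2 i (by omega), ← h2 (i + 1) (by omega)]] at h3
      rw [h3, hfM.moebiusTransform_eq hf]
      have h4 : (z n).1 = actBy α (partialProd (fun i => (z i).2) n) :=
        congrArg Prod.fst (h2 n le_rfl)
      rw [← h4, hg, mul_zero, mul_zero]
    · rw [hK _ _ hg]

end StatesAndCliques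

/-! ### The theorem -/

theorem theorem2 {A : Type*} [Finite A] (I : SimpleGraph A) {X : Type*} [Finite X]
    [MeasurableSpace X] [DiscreteMeasurableSpace X] [MulAction (TraceMonoid I)ᵐᵒᵖ X]
    (f : X → TraceMonoid I → ℝ) (hf : IsFibredValuation f) (hfM : IsMoebius f) :
    (∃! P : X → Measure (Boundary I), IsMarkovMeasure P ∧
      ∀ α x, f α x = (P α).real (Boundary.cylinder x)) ∧
    ∀ P : X → Measure (Boundary I), IsMarkovMeasure P →
      (∀ α x, f α x = (P α).real (Boundary.cylinder x)) →
      ∀ α : X,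
        (∃! Q : Measure (ℕ → X × NonemptyClique I),
          IsMarkovChain (initialWeight f α) (transitionMatrix f) Q (fun i ω => ω i)) ∧
        ∀ {Ω : Type*} [MeasurableSpace Ω] (Q : Measure Ω) (Z : ℕ → Ω → X × NonemptyClique I),
          IsMarkovChain (initialWeight f α) (transitionMatrix f) Q Z →
            Measurable (fun ω => infiniteTrace fun i => (Z i ω).2) ∧
            Q.map (fun ω => infiniteTrace fun i => (Z i ω).2) = P α := by
  choose Q hQ using hfM.exists_isMarkovChain hf
  constructor
  · have hcyl := fun α x => (hQ α).map_infiniteTrace_real_cylinder hf hfM x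
    refine ⟨fun α => (Q α).map fun ω => infiniteTrace fun i => (ω i).2, ⟨⟨fun α => ?_, ?_⟩, ?_⟩, ?_⟩
    · have := (hQ α).isProbabilityMeasure
      exact Measure.isProbabilityMeasure_map
        (measurable_infiniteTrace (hQ α).measurable_clique).aemeasurable
    · intro α x y
      rw [hcyl, hcyl, hcyl, hf.map_mul]
    · exact fun α x => (hcyl α x).symm
    · rintro P ⟨hP, hfP⟩
      funext α
      have := hP.isProbabilityMeasure α
      have := (hQ α).isProbabilityMeasure
      have := Measure.isProbabilityMeasure_map (μ := Q α)
        (measurable_infiniteTrace (hQ α).measurable_clique).aemeasurable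
      exact Boundary.measure_ext fun x => by rw [← hfP, hcyl]
  · intro P hP hfP α
    refine ⟨⟨Q α, hQ α, fun Q' hQ' => hQ'.unique (hQ α)⟩, fun {Ω} _ R Z hR => ?_⟩
    have hm := measurable_infiniteTrace hR.measurable_clique
    refine ⟨hm, ?_⟩
    have := hP.isProbabilityMeasure α
    have := hR.isProbabilityMeasure
    have := Measure.isProbabilityMeasure_map (μ := R) hm.aemeasurable
    exact Boundary.measure_ext fun x => by
      rw [hR.map_infiniteTrace_real_cylinder hf hfM, hfP]

end
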